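/- Let $\Bbbk$ be a unital commutative ring and let $n\ge 1$, $d\ge 2$ be integers. Let $NC_A(n,d)$ be the associative unital $\Bbbk$-algebra generated by $T_1,\dots,T_n$ with relations $$T_iT_{i+1}T_i=T_{i+1}T_iT_{i+1}\ (0<i<n),\qquad T_iT_j=T_jT_i\ (|i-j|>1),\qquad T_1^2=\cdots=T_{n-1}^2=T_n^d=0 .$$ A nonzero word is a nonzero element of $NC_A(n,d)$ that is a product $T_{i_1}\cdots T_{i_l}$ of generators ($l\ge 0$). Let $\ell_{A_{n-1}}$ be the usual length function of the symmetric group $S_n$ with respect to the simple reflections $s_i=(i\ \,i+1)$, $1\le i\le n-1$, and let $w'_\circ\in S_n$ be its unique longest element, the order-reversing permutation. For $w\in S_n$ put $T_w=T_{i_1}\cdots T_{i_l}$, where $w=s_{i_1}\cdots s_{i_l}$ is a reduced expression; this does not depend on the reduced expression. Let $R_{n-1}$ be the subalgebra generated by $T_1,\dots,T_{n-1}$, let $NC_{A_{n-1}}((2,\dots,2))$ be the usual nil-Coxeter algebra of $S_n$ (generators $T_1,\dots,T_{n-1}$, the braid relations, and $T_i^2=0$ for all $i$), in which the words $T_w$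 are defined in the same way, let $\mathfrak m$ be the two-sided ideal of $NC_A(n,d)$ generated by $T_1,\dots,T_n$, and let $l_{n,d}:=\ell_{A_{n-1}}(w'_\circ)+d+n-2$. 1. Suppose $\Bbbk\ne 0$. The algebra map $NC_{A_{n-1}}((2,\dots,2))\to NC_A(n,d)$ with $T_i\mapsto T_i$ is injective with image $R_{n-1}$ and sends $T_w$ to $T_w$. There is a length function $\ell$ on the nonzero words of $NC_A(n,d)$, i.e. a function with $\ell(T_{i_1}\cdots T_{i_l})=l$ whenever $T_{i_1}\cdots T_{i_l}\neq 0$. It restricts to the usual length function on $R_{n-1}\simeq NC_{A_{n-1}}((2,\dots,2))$, that is, $T_w\ne 0$ and $\ell(T_w)=\ell_{A_{n-1}}(w)$ for all $w\in S_n$. Moreover, for all $w\in S_n$, $k\in[1,d-1]$, $m\in[1,n]$, the word $T_wT_n^kT_{n-1}\cdots T_m$ is nonzero and $$\ell(T_wT_n^kT_{n-1}\cdots T_m)=\ell_{A_{n-1}}(w)+k+n-m .$$ 2. Suppose $\Bbbk\ne 0$. The word $T_{w'_\circ}T_n^{d-1}T_{n-1}\cdots T_1$ is nonzero of length $l_{n,d}$,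 and every other nonzero word of $NC_A(n,d)$ has strictly smaller length. 3. If $\Bbbk$ is a field, then $NC_A(n,d)$ is a local ring, and $\mathfrak m$ is its unique maximal left ideal, its unique maximal right ideal, and its unique maximal two-sided ideal. For every $\Bbbk$, the ideal $\mathfrak m$ is nilpotent, with $\mathfrak m^{1+l_{n,d}}=0$. -/

import Mathlib

/-! ### Generalized nil-Coxeter algebras -/

/-- The defining relations, inside the free algebra on letters indexed by `I`, of the generalized
nil-Coxeter algebra attached to the off-diagonal part of a Coxeter matrix `M` (with the convention
of Mathlib that the entry `0` stands for `∞`) and to the orders `e i` on the diagonal: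
the braid relations `T_i T_j T_i ⋯ = T_j T_i T_j ⋯` with `M i j` factors on either side
(this is the void relation `1 = 1` if `M i j = ∞`), and `T_i ^ (e i) = 0`. -/
inductive GenNilCoxeter.Rel (R : Type*) [CommRing R] {I : Type*} (M : CoxeterMatrix I)
    (e : I → ℕ) : FreeAlgebra R I → FreeAlgebra R I → Prop
  | braid (i j : I) (h : i ≠ j) : GenNilCoxeter.Rel R M e
      ((CoxeterSystem.braidWord M i j).map (FreeAlgebra.ι R)).prod
      ((CoxeterSystem.braidWord M j i).map (FreeAlgebra.ι R)).prod
  | order (i : I) : GenNilCoxeter.Rel R M e (FreeAlgebra.ι R i ^ e i) 0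

/-- The generalized nil-Coxeter algebra `NC_M(e)` over `R`. -/
abbrev GenNilCoxeter (R : Type*) [CommRing R] {I : Type*} (M : CoxeterMatrix I) (e : I → ℕ) :
    Type _ :=
  RingQuot (GenNilCoxeter.Rel R M e)

namespace GenNilCoxeter

section

variable (R : Type*) [CommRing R] {I : Type*} (M : CoxeterMatrix I) (e : I → ℕ)

/-- The generator `T_i`. -/
def T (i : I) : GenNilCoxeter R M e :=
  RingQuot.mkAlgHom R (Rel R M e) (FreeAlgebra.ι R i)

/-- The word `T_{i_1} ⋯ T_{i_l}` attached to the list `[i_1, …, i_l]`. -/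
def word (ω : List I) : GenNilCoxeter R M e :=
  (ω.map (T R M e)).prod

/-- The type of nonzero words: the nonzero elements which are products of generators. -/
def NonzeroWord : Type _ :=
  {x : GenNilCoxeter R M e // x ≠ 0 ∧ ∃ ω : List I, word R M e ω = x}

/-- `ℓ` is the length function of the algebra: it assigns to each nonzero word the number of
letters in *every* expression of it as a product of generators. -/
def IsLengthFunction (ℓ : NonzeroWord R M e → ℕ) : Prop :=
  ∀ (ω : List I) (h : word R M e ω ≠ 0), ℓ ⟨word R M e ω, h, ω, rfl⟩ = ω.length

/-- The two-sided ideal generated by all `T_i`. -/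
def maxIdeal : TwoSidedIdeal (GenNilCoxeter R M e) :=
  TwoSidedIdeal.span (Set.range (T R M e))

end

end GenNilCoxeter

/-! ### The symmetric group `S_n` as the Coxeter group of type `A_{n-1}` -/

/-- The simple reflections of `S_n`; the index `i : Fin (n - 1)` stands for the adjacent
transposition `s_{i+1}`. -/
def adjSwap (n : ℕ) (i : Fin (n - 1)) : Equiv.Perm (Fin n) :=
  Equiv.swap ⟨i, by omega⟩ ⟨i + 1, by omega⟩

/-- The product in `S_n` of a word in the simple reflections. -/
def permProd (n : ℕ) (ω : List (Fin (n - 1))) : Equiv.Perm (Fin n) :=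
  (ω.map (adjSwap n)).prod

/-- The usual length function of type `A_{n-1}`: the least length of a word in the simple
reflections with product `w`. -/
noncomputable def permLength {n : ℕ} (w : Equiv.Perm (Fin n)) : ℕ :=
  sInf {l : ℕ | ∃ ω : List (Fin (n - 1)), ω.length = l ∧ permProd n ω = w}

/-- `ω` is a reduced word of `w`. -/
def IsReducedWord {n : ℕ} (ω : List (Fin (n - 1))) (w : Equiv.Perm (Fin n)) : Prop :=
  permProd n ω = w ∧ ω.length = permLength w

theorem exists_permProd_eq {n : ℕ} (w : Equiv.Perm (Fin n)) :
    ∃ ω : List (Fin (n - 1)), permProd n ω = w := by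
  cases n with
  | zero => exact ⟨[], Subsingleton.elim _ _⟩
  | succ n =>
    have hw : w ∈ Submonoid.closure
        (Set.range fun i : Fin n ↦ Equiv.swap i.castSucc i.succ) := by
      rw [Equiv.Perm.mclosure_swap_castSucc_succ]; trivial
    induction hw using Submonoid.closure_induction with
    | mem x hx =>
      obtain ⟨i, rfl⟩ := hx
      exact ⟨[i], by simp only [permProd, List.map_cons, List.map_nil, List.prod_singleton]; rfl⟩
    | one => exact ⟨[], rfl⟩
    | mul x y _ _ hx hy =>
      obtain ⟨a, rfl⟩ := hx
      obtain ⟨b, rfl⟩ := hy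
      exact ⟨a ++ b, by simp [permProd]⟩

theorem exists_isReducedWord {n : ℕ} (w : Equiv.Perm (Fin n)) :
    ∃ ω : List (Fin (n - 1)), IsReducedWord ω w := by
  have hne : {l : ℕ | ∃ ω : List (Fin (n - 1)), ω.length = l ∧ permProd n ω = w}.Nonempty := by
    obtain ⟨ω, hω⟩ := exists_permProd_eq w
    exact ⟨ω.length, ω, rfl, hω⟩
  obtain ⟨ω, h1, h2⟩ := Nat.sInf_mem hne
  exact ⟨ω, h2, h1⟩

/-- A reduced word of `w`. -/
noncomputable def reducedWord {n : ℕ} (w : Equiv.Perm (Fin n)) : List (Fin (n - 1)) :=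
  (exists_isReducedWord w).choose

/-! ### The algebras of type `A` -/

/-- The usual nil-Coxeter algebra `NC_{A_{n-1}}((2,…,2))` of `S_n`. -/
abbrev NilA (R : Type*) [CommRing R] (n : ℕ) : Type _ :=
  GenNilCoxeter R (CoxeterMatrix.A (n - 1)) (fun _ ↦ 2)

/-- The diagonal `(2,…,2,d)`. -/
def orderA (n d : ℕ) (i : Fin n) : ℕ :=
  if (i : ℕ) + 1 = n then d else 2

/-- The algebra `NC_A(n,d) = NC_{A_n}((2,…,2,d))`. -/
abbrev NCA (R : Type*) [CommRing R] (n d : ℕ) : Type _ :=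
  GenNilCoxeter R (CoxeterMatrix.A n) (orderA n d)

namespace NilA

/-- The basis word `T_w`, `w ∈ S_n`, of the usual nil-Coxeter algebra. -/
noncomputable def Tw (R : Type*) [CommRing R] {n : ℕ} (w : Equiv.Perm (Fin n)) : NilA R n :=
  GenNilCoxeter.word R _ _ (reducedWord w)

end NilA

namespace NCA

section

variable (R : Type*) [CommRing R] (n d : ℕ)

/-- The generator of `NC_A(n,d)` attached to `i : Fin n`; it stands for `T_{i+1}`. -/
def T (i : Fin n) : NCA R n d := GenNilCoxeter.T R _ _ i

/-- Words in the generators of `NC_A(n,d)`. -/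
def word (ω : List (Fin n)) : NCA R n d := GenNilCoxeter.word R _ _ ω

/-- The inclusion of the letters `1, …, n - 1` into the letters `1, …, n`. -/
def incl (n : ℕ) (i : Fin (n - 1)) : Fin n := Fin.castLE (Nat.sub_le n 1) i

/-- The subalgebra `R_{n-1}` generated by `T_1, …, T_{n-1}`. -/
def subalgR : Subalgebra R (NCA R n d) :=
  Algebra.adjoin R (Set.range fun i : Fin (n - 1) ↦ T R n d (incl n i))

variable {n}

/-- The word `T_w`, for `w ∈ S_n`, read off from a reduced word of `w`. -/
noncomputable def Tw (w : Equiv.Perm (Fin n)) : NCA R n d :=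
  word R n d ((reducedWord w).map (incl n))

/-- The letters of the descending word `T_{n-1} T_{n-2} ⋯ T_m` (empty if `m = n`). -/
def descLetters (n m : ℕ) : List (Fin n) :=
  ((List.finRange n).filter fun (i : Fin n) ↦ m ≤ i.val + 1 ∧ i.val + 1 < n).reverse

/-- The word `T_w T_n^a T_{n-1} T_{n-2} ⋯ T_m`. -/
noncomputable def stdWord (hn : 1 ≤ n) (w : Equiv.Perm (Fin n)) (a m : ℕ) : NCA R n d :=
  Tw R d w * T R n d ⟨n - 1, by omega⟩ ^ a * word R n d (descLetters n m)

end

theorem map_alternatingWord {I J : Type*} (f : I → J) (i j : I) (m : ℕ) :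
    (CoxeterSystem.alternatingWord i j m).map f =
      CoxeterSystem.alternatingWord (f i) (f j) m := by
  induction m generalizing i j with
  | zero => rfl
  | succ m ih => simp [CoxeterSystem.alternatingWord, ih]

/-- The algebra map `NC_{A_{n-1}}((2,…,2)) → NC_A(n,d)` which sends `T_i` to `T_i`. -/
def fromNilA (R : Type*) [CommRing R] (n d : ℕ) : NilA R n →ₐ[R] NCA R n d :=
  RingQuot.liftAlgHom R ⟨FreeAlgebra.lift R fun i ↦ T R n d (incl n i), by
    have key : ∀ l : List (Fin (n - 1)),
        FreeAlgebra.lift R (fun i ↦ T R n d (incl n i)) (l.map (FreeAlgebra.ι R)).prod =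
          RingQuot.mkAlgHom R (GenNilCoxeter.Rel R (CoxeterMatrix.A n) (orderA n d))
            ((l.map (incl n)).map (FreeAlgebra.ι R)).prod := by
      intro l
      simp [map_list_prod, Function.comp_def, T, GenNilCoxeter.T]
    intro x y h
    cases h with
    | braid i j hij =>
      have hM : CoxeterMatrix.A (n - 1) i j = CoxeterMatrix.A n (incl n i) (incl n j) := by
        simp [CoxeterMatrix.A, incl, Fin.ext_iff]
      have hM' : CoxeterMatrix.A (n - 1) j i = CoxeterMatrix.A n (incl n j) (incl n i) := by
        simp [CoxeterMatrix.A, incl, Fin.ext_iff]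
      rw [key, key, map_alternatingWord (incl n), map_alternatingWord (incl n), hM, hM']
      refine RingQuot.mkAlgHom_rel R (GenNilCoxeter.Rel.braid _ _ ?_)
      intro h
      exact hij (by simpa [incl, Fin.ext_iff] using h)
    | order i =>
      have h2 : orderA n d (incl n i) = 2 := by
        have h1 : ((incl n i : Fin n) : ℕ) + 1 ≠ n := by
          have := i.isLt
          have h3 : ((incl n i : Fin n) : ℕ) = i := rfl
          omega
        exact if_neg h1
      have := RingQuot.mkAlgHom_rel R
        (GenNilCoxeter.Rel.order (R := R) (M := CoxeterMatrix.A n) (e := orderA n d) (incl n i))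
      simpa [T, GenNilCoxeter.T, h2] using this⟩

/-- The number `l_{n,d} = ℓ(w'_∘) + d + n - 2`, where `w'_∘ ∈ S_n` is the permutation
reversing the order. -/
noncomputable def longestLength (n d : ℕ) : ℕ :=
  permLength (Fin.revPerm : Equiv.Perm (Fin n)) + d + n - 2

end NCA

/-! ### Inversions of permutations -/

/-! The words `T_w` and `T_w T_n^k T_{n-1} ⋯ T_m` exhaust the nonzero words, and none of them
vanishes.

Exhaustion (`IsNormal.mul_T`, `isNormal_word`): multiplying a standard word on the right by a
generator gives zero or a standard word with one more letter. A generator can lengthen the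
descending tail, raise the power of `T_n`, or travel left through the tail and the power by
commutation and braid moves until `T_w` absorbs or annihilates it. The products that vanish do so by
`T_i^2 = 0`, `T_n^d = 0`, or the identity `sq_mul_descProd_mul`. That `T_w` is well defined, and how
it multiplies, rests on the inversion count for the length in `S_n` and on Matsumoto's theorem
(`IsReducedWord.prod_eq`).

Nonvanishing (`stdWord_ne_zero`, `Tw_ne_zero`): the algebra acts on functions of pairs of a sequence
and a counter (`stepRep`). Generators sort adjacent entries into descending order. A largest element
`⊤`, waiting just beyond the permuted entries, is pulled in by the first `T_n`; the counter records
further powers of `T_n`, and the descending tail moves `⊤` to the left. A word is nonzero as soon as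
it leaves one state alive.

The relations are homogeneous, so `T_i ↦ T_i X` defines a map to polynomials over the algebra which
reads off the number of letters of a nonzero word. The maximum of `ℓ(w) + k + (n - m)` is attained
only at `w = w'_∘`, `k = d - 1`, `m = 1`. Longer words vanish, hence the augmentation ideal is
nilpotent; over a field, an element is then a unit exactly if its augmentation is nonzero. -/

theorem adjSwap_val {n : ℕ} (j : Fin (n - 1)) (a : Fin n) :
    (adjSwap n j a : ℕ) = if (a : ℕ) = j then (j : ℕ) + 1 else if (a : ℕ) = j + 1 then j else a := by
  simp only [adjSwap, Equiv.swap_apply_def, Fin.ext_iff]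
  split_ifs <;> rfl

theorem adjSwap_mul_self {n : ℕ} (j : Fin (n - 1)) : adjSwap n j * adjSwap n j = 1 :=
  Equiv.swap_mul_self _ _

theorem mul_adjSwap_cancel {n : ℕ} (w : Equiv.Perm (Fin n)) (j : Fin (n - 1)) :
    w * adjSwap n j * adjSwap n j = w := by
  rw [mul_assoc, adjSwap_mul_self, mul_one]

/-- The inversions of a permutation. -/
def invSet {n : ℕ} (w : Equiv.Perm (Fin n)) : Finset (Fin n × Fin n) :=
  Finset.univ.filter fun p ↦ p.1 < p.2 ∧ w p.2 < w p.1

theorem mem_invSet {n : ℕ} {w : Equiv.Perm (Fin n)} {p : Fin n × Fin n} :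
    p ∈ invSet w ↔ p.1 < p.2 ∧ w p.2 < w p.1 := by
  simp [invSet]

/-- The lower position moved by `adjSwap n j`. -/
def loPos {n : ℕ} (j : Fin (n - 1)) : Fin n := ⟨j, by omega⟩

/-- The upper position moved by `adjSwap n j`. -/
def hiPos {n : ℕ} (j : Fin (n - 1)) : Fin n := ⟨j + 1, by omega⟩

theorem adjSwap_loPos {n : ℕ} (j : Fin (n - 1)) : adjSwap n j (loPos j) = hiPos j :=
  Equiv.swap_apply_left _ _

theorem adjSwap_hiPos {n : ℕ} (j : Fin (n - 1)) : adjSwap n j (hiPos j) = loPos j :=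
  Equiv.swap_apply_right _ _

theorem adjSwap_of_ne {n : ℕ} (j : Fin (n - 1)) (a : Fin n) (h1 : (a : ℕ) ≠ j)
    (h2 : (a : ℕ) ≠ j + 1) : adjSwap n j a = a := by
  apply Fin.ext
  rw [adjSwap_val, if_neg h1, if_neg h2]

/-- `w` has an ascent at `j`. -/
def IsAscent {n : ℕ} (w : Equiv.Perm (Fin n)) (j : Fin (n - 1)) : Prop :=
  w (loPos j) < w (hiPos j)

theorem loPos_ne_hiPos {n : ℕ} (j : Fin (n - 1)) : loPos j ≠ hiPos j := by
  simp [loPos, hiPos, Fin.ext_iff]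

theorem not_isAscent_iff {n : ℕ} (w : Equiv.Perm (Fin n)) (j : Fin (n - 1)) :
    ¬ IsAscent w j ↔ w (hiPos j) < w (loPos j) := by
  have : w (loPos j) ≠ w (hiPos j) := fun h ↦ loPos_ne_hiPos j (w.injective h)
  simp only [IsAscent, not_lt]
  exact ⟨fun h ↦ lt_of_le_of_ne h this.symm, le_of_lt⟩

theorem isAscent_mul_adjSwap {n : ℕ} (w : Equiv.Perm (Fin n)) (j : Fin (n - 1)) :
    IsAscent (w * adjSwap n j) j ↔ ¬ IsAscent w j := by
  rw [not_isAscent_iff, IsAscent, Equiv.Perm.mul_apply, Equiv.Perm.mul_apply, adjSwap_loPos,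
    adjSwap_hiPos]

theorem adjSwap_lt_adjSwap {n : ℕ} (j : Fin (n - 1)) {a b : Fin n} (hab : a < b)
    (h : ¬ (a = loPos j ∧ b = hiPos j)) : adjSwap n j a < adjSwap n j b := by
  rw [Fin.lt_def, adjSwap_val, adjSwap_val]
  simp only [loPos, hiPos, Fin.ext_iff, Fin.lt_def] at h hab
  split_ifs <;> omega

/-- Applying the transposition to both positions matches the inversions of `w` with those of `w *
adjSwap n j` other than the pair `(loPos j, hiPos j)`, because that pair is the only one whose order
the transposition reverses. -/
theorem card_invSet_mul_adjSwap {n : ℕ} {w : Equiv.Perm (Fin n)} {j : Fin (n - 1)}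
    (h : IsAscent w j) : (invSet (w * adjSwap n j)).card = (invSet w).card + 1 := by
  have hmem : (loPos j, hiPos j) ∈ invSet (w * adjSwap n j) := by
    simp only [mem_invSet, Equiv.Perm.mul_apply, adjSwap_loPos, adjSwap_hiPos]
    exact ⟨by simp [loPos, hiPos, Fin.lt_def], h⟩
  have hinv : ∀ a, adjSwap n j (adjSwap n j a) = a := fun a ↦ by
    rw [← Equiv.Perm.mul_apply, adjSwap_mul_self, Equiv.Perm.one_apply]
  rw [← Finset.card_erase_add_one hmem]
  congr 1
  refine Finset.card_nbij' (fun p ↦ (adjSwap n j p.1, adjSwap n j p.2))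
    (fun p ↦ (adjSwap n j p.1, adjSwap n j p.2)) ?_ ?_ ?_ ?_
  · rintro ⟨a, b⟩ hp
    simp only [Finset.mem_coe, Finset.mem_erase, mem_invSet, Equiv.Perm.mul_apply, ne_eq,
      Prod.mk.injEq] at hp ⊢
    exact ⟨adjSwap_lt_adjSwap j hp.2.1 hp.1, hp.2.2⟩
  · rintro ⟨a, b⟩ hp
    simp only [Finset.mem_coe, Finset.mem_erase, mem_invSet, Equiv.Perm.mul_apply, ne_eq,
      Prod.mk.injEq, hinv] at hp ⊢
    refine ⟨?_, adjSwap_lt_adjSwap j hp.1 ?_, hp.2⟩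
    swap
    · rintro ⟨rfl, rfl⟩
      exact absurd hp.2 (not_lt.2 (le_of_lt h))
    · rintro ⟨h1, h2⟩
      have h1' := congrArg (adjSwap n j) h1
      have h2' := congrArg (adjSwap n j) h2
      rw [hinv, adjSwap_loPos] at h1'
      rw [hinv, adjSwap_hiPos] at h2'
      have := hp.1
      rw [h1', h2'] at this
      simp [loPos, hiPos, Fin.lt_def] at this
  · rintro ⟨a, b⟩ _
    simp [hinv]
  · rintro ⟨a, b⟩ _
    simp [hinv]

theorem card_invSet_mul_adjSwap_of_not {n : ℕ} {w : Equiv.Perm (Fin n)} {j : Fin (n - 1)}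
    (h : ¬ IsAscent w j) : (invSet (w * adjSwap n j)).card + 1 = (invSet w).card := by
  rw [← isAscent_mul_adjSwap] at h
  rw [← card_invSet_mul_adjSwap h, mul_adjSwap_cancel]

theorem permProd_append {n : ℕ} (ω ω' : List (Fin (n - 1))) :
    permProd n (ω ++ ω') = permProd n ω * permProd n ω' := by
  simp [permProd]

theorem permProd_singleton {n : ℕ} (j : Fin (n - 1)) : permProd n [j] = adjSwap n j := by
  simp [permProd]

theorem card_invSet_permProd_le {n : ℕ} (ω : List (Fin (n - 1))) :
    (invSet (permProd n ω)).card ≤ ω.length := by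
  induction ω using List.reverseRecOn with
  | nil =>
    have : invSet (permProd n []) = ∅ := by
      ext ⟨a, b⟩
      simp only [permProd, List.map_nil, List.prod_nil, invSet, Finset.mem_filter, Finset.mem_univ,
        true_and, Equiv.Perm.one_apply, Finset.notMem_empty, iff_false, not_and, not_lt]
      exact le_of_lt
    simp [this]
  | append_singleton ω j ih =>
    rw [permProd_append, permProd_singleton, List.length_append, List.length_singleton]
    by_cases h : IsAscent (permProd n ω) j
    · rw [card_invSet_mul_adjSwap h]; omega
    · have := card_invSet_mul_adjSwap_of_not h; omega

/-- Such a `w` is an order automorphism of a finite chain, and the identity is the only one. -/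
theorem eq_one_of_forall_isAscent {n : ℕ} {w : Equiv.Perm (Fin n)} (h : ∀ j, IsAscent w j) :
    w = 1 := by
  cases n with
  | zero => exact Subsingleton.elim _ _
  | succ n =>
    have hmono : StrictMono w := Fin.strictMono_iff_lt_succ.2 fun i ↦ h i
    have := Subsingleton.elim (hmono.orderIsoOfSurjective w w.surjective) (OrderIso.refl _)
    ext a
    have h2 := DFunLike.congr_fun this a
    simpa using congrArg Fin.val h2

/-- Bubble sort: as long as `w` is not the identity it has a descent, and undoing it removes exactly
one inversion. -/
theorem exists_permProd_eq_of_card {n : ℕ} (w : Equiv.Perm (Fin n)) :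
    ∃ ω : List (Fin (n - 1)), ω.length = (invSet w).card ∧ permProd n ω = w := by
  induction hk : (invSet w).card generalizing w with
  | zero =>
    refine ⟨[], rfl, ?_⟩
    rw [eq_one_of_forall_isAscent (w := w)]
    · simp [permProd]
    · intro j
      by_contra h
      have := card_invSet_mul_adjSwap_of_not h
      omega
  | succ k ih =>
    have : ∃ j, ¬ IsAscent w j := by
      by_contra! h
      have h1 := eq_one_of_forall_isAscent h
      have h2 := card_invSet_permProd_le (n := n) []
      have h3 : permProd n [] = 1 := by simp [permProd]
      rw [h3, ← h1, hk] at h2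
      simp at h2
    obtain ⟨j, hj⟩ := this
    have h1 := card_invSet_mul_adjSwap_of_not hj
    obtain ⟨ω, h2, h3⟩ := ih (w * adjSwap n j) (by omega)
    exact ⟨ω ++ [j], by simp [h2], by rw [permProd_append, permProd_singleton, h3,
      mul_adjSwap_cancel]⟩

theorem permLength_eq_card_invSet {n : ℕ} (w : Equiv.Perm (Fin n)) :
    permLength w = (invSet w).card := by
  apply le_antisymm
  · exact Nat.sInf_le (exists_permProd_eq_of_card w)
  · obtain ⟨ω, h1, h2⟩ := exists_isReducedWord w
    rw [← h2, ← h1]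
    exact card_invSet_permProd_le ω

theorem permLength_mul_adjSwap {n : ℕ} {w : Equiv.Perm (Fin n)} {j : Fin (n - 1)}
    (h : IsAscent w j) : permLength (w * adjSwap n j) = permLength w + 1 := by
  simp only [permLength_eq_card_invSet, card_invSet_mul_adjSwap h]

theorem permLength_mul_adjSwap_of_not {n : ℕ} {w : Equiv.Perm (Fin n)} {j : Fin (n - 1)}
    (h : ¬ IsAscent w j) : permLength (w * adjSwap n j) + 1 = permLength w := by
  simp only [permLength_eq_card_invSet, card_invSet_mul_adjSwap_of_not h]

/-- For the reversal every pair is an inversion. If the same holds for `w`, then `w * Fin.revPerm`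
is increasing, hence the identity. -/
theorem permLength_lt_revPerm {n : ℕ} {w : Equiv.Perm (Fin n)} (hw : w ≠ Fin.revPerm) :
    permLength w < permLength (n := n) Fin.revPerm := by
  simp only [permLength_eq_card_invSet]
  apply Finset.card_lt_card
  have hrev : invSet (n := n) Fin.revPerm = Finset.univ.filter fun p ↦ p.1 < p.2 := by
    ext ⟨a, b⟩
    simp [invSet]
  rw [hrev]
  refine Finset.ssubset_iff_subset_ne.2 ⟨fun p hp ↦ ?_, fun heq ↦ hw ?_⟩
  · simp only [invSet, Finset.mem_filter, Finset.mem_univ, true_and] at hp ⊢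
    exact hp.1
  · have hanti : ∀ a b : Fin n, a < b → w b < w a := fun a b hab ↦ by
      have : (a, b) ∈ invSet w := by rw [heq]; simpa using hab
      simp only [invSet, Finset.mem_filter] at this
      exact this.2.2
    have hmono : StrictMono (w * Fin.revPerm : Equiv.Perm (Fin n)) := fun a b hab ↦ by
      simp only [Equiv.Perm.mul_apply, Fin.revPerm_apply]
      exact hanti _ _ (by simpa using hab)
    have h1 : w * Fin.revPerm = 1 := eq_one_of_forall_isAscent fun j ↦
      hmono (by simp [loPos, hiPos, Fin.lt_def])
    ext a
    have h2 := DFunLike.congr_fun h1 (Fin.rev a)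
    simp only [Equiv.Perm.mul_apply, Fin.revPerm_apply, Fin.rev_rev, Equiv.Perm.one_apply] at h2
    simp [h2]

theorem permLength_le_revPerm {n : ℕ} (w : Equiv.Perm (Fin n)) :
    permLength w ≤ permLength (n := n) Fin.revPerm := by
  by_cases h : w = Fin.revPerm
  · rw [h]
  · exact (permLength_lt_revPerm h).le

/-! ### Reduced words -/

theorem isReducedWord_nil {n : ℕ} : IsReducedWord (n := n) [] 1 :=
  ⟨by simp [permProd], by
    have h : permLength (1 : Equiv.Perm (Fin n)) ≤ 0 :=
      Nat.sInf_le ⟨[], rfl, by simp [permProd]⟩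
    exact (Nat.le_zero.1 h).symm⟩

theorem isReducedWord_concat {n : ℕ} {w : Equiv.Perm (Fin n)} {j : Fin (n - 1)}
    (h : IsAscent w j) {ω : List (Fin (n - 1))} (hω : IsReducedWord ω w) :
    IsReducedWord (ω ++ [j]) (w * adjSwap n j) :=
  ⟨by rw [permProd_append, permProd_singleton, hω.1],
    by rw [permLength_mul_adjSwap h, List.length_append, hω.2, List.length_singleton]⟩

theorem isReducedWord_concat_of_not {n : ℕ} {w : Equiv.Perm (Fin n)} {j : Fin (n - 1)}
    (h : ¬ IsAscent w j) {ω : List (Fin (n - 1))} (hω : IsReducedWord ω (w * adjSwap n j)) :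
    IsReducedWord (ω ++ [j]) w := by
  have := isReducedWord_concat ((isAscent_mul_adjSwap w j).2 h) hω
  rwa [mul_adjSwap_cancel] at this

theorem IsReducedWord.of_concat {n : ℕ} {w : Equiv.Perm (Fin n)} {j : Fin (n - 1)}
    {ω : List (Fin (n - 1))} (hω : IsReducedWord (ω ++ [j]) w) :
    ¬ IsAscent w j ∧ IsReducedWord ω (w * adjSwap n j) := by
  have h1 : permProd n ω = w * adjSwap n j := by
    rw [← hω.1, permProd_append, permProd_singleton, mul_adjSwap_cancel]
  have h2 : ω.length + 1 = permLength w := by simpa using hω.2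
  have h3 : permLength (w * adjSwap n j) ≤ ω.length := Nat.sInf_le ⟨ω, rfl, h1⟩
  have h4 : ¬ IsAscent w j := fun h ↦ by
    have := permLength_mul_adjSwap h
    omega
  have h5 := permLength_mul_adjSwap_of_not h4
  exact ⟨h4, h1, by omega⟩

theorem isReducedWord_reducedWord {n : ℕ} (w : Equiv.Perm (Fin n)) :
    IsReducedWord (reducedWord w) w :=
  (exists_isReducedWord w).choose_spec

theorem isAscent_mul_adjSwap_of_far {n : ℕ} (w : Equiv.Perm (Fin n)) {i j : Fin (n - 1)}
    (h : (i : ℕ) + 1 < j ∨ (j : ℕ) + 1 < i) : IsAscent (w * adjSwap n i) j ↔ IsAscent w j := by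
  rw [IsAscent, IsAscent, Equiv.Perm.mul_apply, Equiv.Perm.mul_apply, adjSwap_of_ne,
    adjSwap_of_ne] <;> simp only [loPos, hiPos] <;> omega

theorem adjSwap_comm {n : ℕ} {i j : Fin (n - 1)}
    (h : (i : ℕ) + 1 < j ∨ (j : ℕ) + 1 < i) :
    adjSwap n i * adjSwap n j = adjSwap n j * adjSwap n i := by
  ext a
  simp only [Equiv.Perm.mul_apply, adjSwap_val]
  split_ifs <;> omega

theorem adjSwap_braid {n : ℕ} {i j : Fin (n - 1)} (h : (j : ℕ) = i + 1) :
    adjSwap n i * adjSwap n j * adjSwap n i = adjSwap n j * adjSwap n i * adjSwap n j := by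
  have h2 : loPos j = hiPos i := Fin.ext h
  change Equiv.swap (loPos i) (hiPos i) * Equiv.swap (loPos j) (hiPos j) *
    Equiv.swap (loPos i) (hiPos i) = Equiv.swap (loPos j) (hiPos j) *
    Equiv.swap (loPos i) (hiPos i) * Equiv.swap (loPos j) (hiPos j)
  have h3 := loPos_ne_hiPos j
  have h4 : loPos i ≠ hiPos j := by
    simp only [loPos, hiPos, ne_eq, Fin.ext_iff]
    omega
  rw [h2] at h3 ⊢
  rw [Equiv.swap_mul_swap_mul_swap (loPos_ne_hiPos i) h4, Equiv.swap_comm (loPos i),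
    Equiv.swap_comm (hiPos i) (hiPos j), Equiv.swap_mul_swap_mul_swap h3.symm h4.symm]
  exact Equiv.swap_comm _ _

/-- Any two reduced words of a permutation have the same product in a monoid whose elements `t i`
satisfy the braid relations. -/
theorem IsReducedWord.prod_eq {n : ℕ} {A : Type*} [Monoid A] {t : Fin (n - 1) → A}
    (hcomm : ∀ i j : Fin (n - 1), (i : ℕ) + 1 < j → t i * t j = t j * t i)
    (hbraid : ∀ i j : Fin (n - 1), (j : ℕ) = i + 1 → t i * t j * t i = t j * t i * t j)
    {w : Equiv.Perm (Fin n)} {ω ω' : List (Fin (n - 1))} (h : IsReducedWord ω w)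
    (h' : IsReducedWord ω' w) : (ω.map t).prod = (ω'.map t).prod := by
  induction hl : permLength w using Nat.strong_induction_on generalizing w ω ω' with
  | _ l ih =>
  subst hl
  have key : ∀ (v : Equiv.Perm (Fin n)) (i j : Fin (n - 1)) (α β : List (Fin (n - 1))),
      IsReducedWord (α ++ [i]) v → IsReducedWord (β ++ [j]) v → v = w → (i : ℕ) < j →
      ((α ++ [i]).map t).prod = ((β ++ [j]).map t).prod := by
    rintro v i j α β hα hβ rfl hij
    obtain ⟨hi, hα⟩ := hα.of_concat
    obtain ⟨hj, hβ⟩ := hβ.of_concat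
    have hli := permLength_mul_adjSwap_of_not hi
    have hlj := permLength_mul_adjSwap_of_not hj
    simp only [List.map_append, List.prod_append, List.map_cons, List.map_nil, List.prod_singleton]
    -- Both `i` and `j` are descents of `v`. Hence `v` has reduced words `γ j i` and `γ i j` if the
    -- letters are far apart, and `γ i j i` and `γ j i j` if they are adjacent. The induction
    -- hypothesis links these to the two given words, and a single relation links them to each
    -- other.
    rcases Nat.lt_or_ge (i + 1) j with hfar | hnear
    · obtain ⟨γ, hγ⟩ := exists_isReducedWord (v * adjSwap n i * adjSwap n j)
      have h1 : IsReducedWord (γ ++ [j]) (v * adjSwap n i) :=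
        isReducedWord_concat_of_not
          (by rwa [isAscent_mul_adjSwap_of_far v (Or.inl hfar)]) hγ
      have h2 : IsReducedWord (γ ++ [i]) (v * adjSwap n j) := by
        refine isReducedWord_concat_of_not
          (by rwa [isAscent_mul_adjSwap_of_far v (Or.inr hfar)]) ?_
        rwa [mul_assoc, ← adjSwap_comm (Or.inl hfar), ← mul_assoc]
      rw [ih _ (by omega) hα h1 rfl, ih _ (by omega) hβ h2 rfl]
      simp only [List.map_append, List.prod_append, List.map_cons, List.map_nil,
        List.prod_singleton, mul_assoc]
      rw [hcomm i j hfar]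
    · have hj1 : (j : ℕ) = i + 1 := by omega
      have hpos : loPos j = hiPos i := Fin.ext hj1
      have hi2 : adjSwap n i (hiPos j) = hiPos j :=
        adjSwap_of_ne _ _ (by simp only [hiPos]; omega) (by simp only [hiPos]; omega)
      have hj2 : adjSwap n j (loPos i) = loPos i :=
        adjSwap_of_ne _ _ (by simp only [loPos]; omega) (by simp only [loPos]; omega)
      have hi3 : adjSwap n i (loPos j) = loPos i := by rw [hpos, adjSwap_hiPos]
      have hj3 : adjSwap n j (hiPos i) = hiPos j := by rw [← hpos, adjSwap_loPos]
      have hai := (not_isAscent_iff _ _).1 hi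
      have haj := (not_isAscent_iff _ _).1 hj
      rw [hpos] at haj
      -- The three entries of `v` at the positions concerned are decreasing, so each swap in turn
      -- undoes a descent.
      have d1 : ¬ IsAscent (v * adjSwap n i) j := by
        rw [not_isAscent_iff]
        simp only [Equiv.Perm.mul_apply, hi2, hi3]
        exact haj.trans hai
      have d2 : ¬ IsAscent (v * adjSwap n j) i := by
        rw [not_isAscent_iff]
        simp only [Equiv.Perm.mul_apply, hj2, hj3]
        exact haj.trans hai
      have d3 : ¬ IsAscent (v * adjSwap n i * adjSwap n j) i := by
        rw [not_isAscent_iff]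
        simp only [Equiv.Perm.mul_apply, hj2, hj3, hi2, adjSwap_loPos]
        exact haj
      have d4 : ¬ IsAscent (v * adjSwap n j * adjSwap n i) j := by
        rw [not_isAscent_iff]
        simp only [Equiv.Perm.mul_apply, hi2, hj2, adjSwap_hiPos, hpos]
        exact hai
      obtain ⟨γ, hγ⟩ := exists_isReducedWord (v * adjSwap n i * adjSwap n j * adjSwap n i)
      have h1 : IsReducedWord (γ ++ [i] ++ [j]) (v * adjSwap n i) :=
        isReducedWord_concat_of_not d1 (isReducedWord_concat_of_not d3 hγ)
      have h2 : IsReducedWord (γ ++ [j] ++ [i]) (v * adjSwap n j) := by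
        refine isReducedWord_concat_of_not d2 (isReducedWord_concat_of_not d4 ?_)
        rwa [mul_assoc, mul_assoc, ← mul_assoc (adjSwap n j), ← adjSwap_braid hj1, ← mul_assoc,
          ← mul_assoc]
      rw [ih _ (by omega) hα h1 rfl, ih _ (by omega) hβ h2 rfl]
      simp only [List.map_append, List.prod_append, List.map_cons, List.map_nil,
        List.prod_singleton, mul_assoc]
      rw [← mul_assoc (t i), hbraid i j hj1, mul_assoc]
  rcases List.eq_nil_or_concat ω with rfl | ⟨α, i, rfl⟩
  · have : ω'.length = 0 := by rw [h'.2, ← h.2]; rfl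
    rw [List.length_eq_zero_iff.1 this]
  rcases List.eq_nil_or_concat ω' with rfl | ⟨β, j, rfl⟩
  · have := h.2.trans h'.2.symm
    simp at this
  rw [List.concat_eq_append] at h h' ⊢
  rw [List.concat_eq_append]
  rcases lt_trichotomy (i : ℕ) j with hij | hij | hij
  · exact key w i j α β h h' rfl hij
  · obtain rfl : i = j := Fin.ext hij
    obtain ⟨hi, hα⟩ := h.of_concat
    have hβ := h'.of_concat.2
    have hli := permLength_mul_adjSwap_of_not hi
    simp only [List.map_append, List.prod_append]
    rw [ih _ (by omega) hα hβ rfl]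
  · exact (key w j i β α h' h rfl hij).symm

/-! ### Generators and relations in type `A` -/

namespace GenNilCoxeter

section

variable {R : Type*} [CommRing R] {I : Type*} {M : CoxeterMatrix I} {e : I → ℕ}

theorem word_nil : word R M e [] = 1 := rfl

theorem word_append (ω ω' : List I) : word R M e (ω ++ ω') = word R M e ω * word R M e ω' := by
  simp [word]

theorem word_singleton (i : I) : word R M e [i] = T R M e i := by
  simp [word]

theorem word_replicate (k : ℕ) (i : I) : word R M e (List.replicate k i) = T R M e i ^ k := by
  simp [word]

theorem word_eq_mkAlgHom (ω : List I) :
    word R M e ω = RingQuot.mkAlgHom R (Rel R M e) (ω.map (FreeAlgebra.ι R)).prod := by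
  rw [map_list_prod, List.map_map]
  rfl

theorem T_pow (i : I) : T R M e i ^ e i = 0 := by
  have := RingQuot.mkAlgHom_rel R (Rel.order (R := R) (M := M) (e := e) i)
  simpa [T] using this

theorem word_braidWord {i j : I} (h : i ≠ j) :
    word R M e (CoxeterSystem.braidWord M i j) = word R M e (CoxeterSystem.braidWord M j i) := by
  rw [word_eq_mkAlgHom, word_eq_mkAlgHom]
  exact RingQuot.mkAlgHom_rel R (Rel.braid i j h)

theorem map_word {B : Type*} [Ring B] [Algebra R B] (f : GenNilCoxeter R M e →ₐ[R] B)
    (ω : List I) : f (word R M e ω) = (ω.map fun i ↦ f (T R M e i)).prod := by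
  simp [word, map_list_prod, Function.comp_def]

theorem adjoin_range_T : Algebra.adjoin R (Set.range (T R M e)) = ⊤ := by
  have h : Set.range (T R M e) =
      RingQuot.mkAlgHom R (Rel R M e) '' Set.range (FreeAlgebra.ι R) := by
    rw [← Set.range_comp]
    rfl
  rw [h, ← AlgHom.map_adjoin, FreeAlgebra.adjoin_range_ι, Algebra.map_top,
    AlgHom.range_eq_top]
  exact RingQuot.mkAlgHom_surjective R _

/-! ### The filtration by word length -/

variable (R M e) in
/-- The span of the words with at least `k` letters. -/
def wordSpan (k : ℕ) : Submodule R (GenNilCoxeter R M e) :=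
  Submodule.span R {x | ∃ ω : List I, k ≤ ω.length ∧ word R M e ω = x}

theorem word_mem_wordSpan {k : ℕ} {ω : List I} (h : k ≤ ω.length) :
    word R M e ω ∈ wordSpan R M e k :=
  Submodule.subset_span ⟨ω, h, rfl⟩

theorem mul_mem_wordSpan {a b : ℕ} {x y : GenNilCoxeter R M e} (hx : x ∈ wordSpan R M e a)
    (hy : y ∈ wordSpan R M e b) : x * y ∈ wordSpan R M e (a + b) := by
  induction hx using Submodule.span_induction with
  | mem x hx =>
    obtain ⟨ω, hω, rfl⟩ := hx
    induction hy using Submodule.span_induction with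
    | mem y hy =>
      obtain ⟨ω', hω', rfl⟩ := hy
      rw [← word_append]
      exact word_mem_wordSpan (by rw [List.length_append]; omega)
    | zero => rw [mul_zero]; exact Submodule.zero_mem _
    | add y z _ _ hy hz => rw [mul_add]; exact Submodule.add_mem _ hy hz
    | smul r y _ hy => rw [mul_smul_comm]; exact Submodule.smul_mem _ _ hy
  | zero => rw [zero_mul]; exact Submodule.zero_mem _
  | add x z _ _ hx hz => rw [add_mul]; exact Submodule.add_mem _ hx hz
  | smul r x _ hx => rw [smul_mul_assoc]; exact Submodule.smul_mem _ _ hx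

theorem mem_wordSpan_zero (x : GenNilCoxeter R M e) : x ∈ wordSpan R M e 0 := by
  have hx : x ∈ Algebra.adjoin R (Set.range (T R M e)) := by
    rw [adjoin_range_T]
    exact Algebra.mem_top
  induction hx using Algebra.adjoin_induction with
  | mem x hx =>
    obtain ⟨i, rfl⟩ := hx
    rw [← word_singleton]
    exact word_mem_wordSpan (Nat.zero_le _)
  | algebraMap r =>
    rw [Algebra.algebraMap_eq_smul_one, ← word_nil]
    exact Submodule.smul_mem _ _ (word_mem_wordSpan (Nat.zero_le _))
  | add x y _ _ hx hy => exact Submodule.add_mem _ hx hy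
  | mul x y _ _ hx hy => simpa only [add_zero] using mul_mem_wordSpan hx hy

end

/-! ### Relations and universal property in type `A` -/

section

variable {R : Type*} [CommRing R] {n : ℕ} {e : Fin n → ℕ}

theorem braidWord_A_of_far {i j : Fin n} (h : (i : ℕ) + 1 < j ∨ (j : ℕ) + 1 < i) :
    CoxeterSystem.braidWord (CoxeterMatrix.A n) i j = [i, j] := by
  have : CoxeterMatrix.A n i j = 2 := by
    have h1 : i ≠ j := by rintro rfl; omega
    have h2 : ¬ ((j : ℕ) + 1 = i ∨ (i : ℕ) + 1 = j) := by omega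
    simp [CoxeterMatrix.A, h1, h2]
  rw [CoxeterSystem.braidWord, this]
  rfl

theorem braidWord_A_of_near {i j : Fin n} (h : (j : ℕ) = i + 1 ∨ (i : ℕ) = j + 1) :
    CoxeterSystem.braidWord (CoxeterMatrix.A n) i j = [j, i, j] := by
  have : CoxeterMatrix.A n i j = 3 := by
    have h1 : i ≠ j := by rintro rfl; omega
    have h2 : ((j : ℕ) + 1 = i ∨ (i : ℕ) + 1 = j) := by omega
    simp [CoxeterMatrix.A, h1, h2]
  rw [CoxeterSystem.braidWord, this]
  rfl

theorem T_comm {i j : Fin n} (h : (i : ℕ) + 1 < j) :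
    T R (CoxeterMatrix.A n) e i * T R _ e j = T R _ e j * T R _ e i := by
  have := word_braidWord (R := R) (M := CoxeterMatrix.A n) (e := e) (i := i) (j := j)
    (by rintro rfl; omega)
  rw [braidWord_A_of_far (Or.inl h), braidWord_A_of_far (Or.inr h)] at this
  simpa [word] using this

theorem T_braid {i j : Fin n} (h : (j : ℕ) = i + 1) :
    T R (CoxeterMatrix.A n) e i * T R _ e j * T R _ e i =
      T R _ e j * T R _ e i * T R _ e j := by
  have := word_braidWord (R := R) (M := CoxeterMatrix.A n) (e := e) (i := i) (j := j)
    (by rintro rfl; omega)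
  rw [braidWord_A_of_near (Or.inl h), braidWord_A_of_near (Or.inr h)] at this
  simpa [word, mul_assoc] using this.symm

/-- The universal property of the generalized nil-Coxeter algebras of type `A`. -/
def liftA {B : Type*} [Ring B] [Algebra R B] (t : Fin n → B)
    (hcomm : ∀ i j : Fin n, (i : ℕ) + 1 < j → t i * t j = t j * t i)
    (hbraid : ∀ i j : Fin n, (j : ℕ) = i + 1 → t i * t j * t i = t j * t i * t j)
    (horder : ∀ i, t i ^ e i = 0) : GenNilCoxeter R (CoxeterMatrix.A n) e →ₐ[R] B :=
  RingQuot.liftAlgHom R ⟨FreeAlgebra.lift R t, by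
    intro x y h
    cases h with
    | braid i j hij =>
      have hij' : (i : ℕ) ≠ j := fun h ↦ hij (Fin.ext h)
      by_cases hfar : (i : ℕ) + 1 < j ∨ (j : ℕ) + 1 < i
      · rw [braidWord_A_of_far hfar, braidWord_A_of_far hfar.symm]
        rcases hfar with h | h
        · simpa using hcomm i j h
        · simpa using (hcomm j i h).symm
      · have hnear : (j : ℕ) = i + 1 ∨ (i : ℕ) = j + 1 := by omega
        rw [braidWord_A_of_near hnear, braidWord_A_of_near hnear.symm]
        rcases hnear with h | h
        · simpa [mul_assoc] using (hbraid i j h).symm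
        · simpa [mul_assoc] using hbraid j i h
    | order i => simpa using horder i⟩

theorem liftA_T {B : Type*} [Ring B] [Algebra R B] (t : Fin n → B)
    (hcomm : ∀ i j : Fin n, (i : ℕ) + 1 < j → t i * t j = t j * t i)
    (hbraid : ∀ i j : Fin n, (j : ℕ) = i + 1 → t i * t j * t i = t j * t i * t j)
    (horder : ∀ i, t i ^ e i = 0) (i : Fin n) :
    liftA (R := R) t hcomm hbraid horder (T R _ e i) = t i := by
  simp [liftA, T]

end

end GenNilCoxeter

/-! ### Descending products -/

section Desc

variable {A : Type*} [MonoidWithZero A] (t : ℕ → A)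

/-- The product `t (N - 1) * t (N - 2) * ⋯ * t (N - r)`. -/
def descProd (N : ℕ) : ℕ → A
  | 0 => 1
  | r + 1 => descProd N r * t (N - (r + 1))

variable {t}

theorem descProd_mul_of_lt (hcomm : ∀ i j, i + 1 < j → t i * t j = t j * t i)
    {N r j : ℕ} (h : j + r + 1 < N) :
    descProd t N r * t j = t j * descProd t N r := by
  induction r with
  | zero => simp [descProd]
  | succ r ih =>
    rw [descProd, mul_assoc, ← hcomm j _ (by omega), ← mul_assoc, ih (by omega), mul_assoc]

theorem descProd_mul_self {N r : ℕ} (hsq : t (N - (r + 1)) * t (N - (r + 1)) = 0) :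
    descProd t N (r + 1) * t (N - (r + 1)) = 0 := by
  rw [descProd, mul_assoc, hsq, mul_zero]

/-- The factor `t (j + 1)` commutes with the tail up to `t (j + 1) * t j`; there a braid move turns
it into `t j`, which commutes with all the factors on the left. -/
theorem descProd_mul_of_gt (hcomm : ∀ i j, i + 1 < j → t i * t j = t j * t i)
    (hbraid : ∀ i, t i * t (i + 1) * t i = t (i + 1) * t i * t (i + 1))
    {N r j : ℕ} (h1 : N < j + 1 + r) (h2 : j + 1 < N) (hr : r ≤ N) :
    descProd t N r * t (j + 1) = t j * descProd t N r := by
  induction r with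
  | zero => omega
  | succ r ih =>
    rcases Nat.lt_or_ge N (j + 1 + r) with h | h
    · rw [descProd, mul_assoc, hcomm (N - (r + 1)) _ (by omega), ← mul_assoc, ih h (by omega),
        mul_assoc]
    · obtain ⟨r, rfl⟩ : ∃ s, r = s + 1 := ⟨r - 1, by omega⟩
      have e1 : N - (r + 1) = j + 1 := by omega
      have e2 : N - (r + 1 + 1) = j := by omega
      rw [descProd, descProd, e1, e2]
      calc descProd t N r * t (j + 1) * t j * t (j + 1)
          = descProd t N r * (t (j + 1) * t j * t (j + 1)) := by simp only [mul_assoc]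
        _ = descProd t N r * t j * (t (j + 1) * t j) := by rw [← hbraid]; simp only [mul_assoc]
        _ = _ := by
          rw [descProd_mul_of_lt hcomm (by omega)]
          simp only [mul_assoc]

/-- Only the first factor `t N` is adjacent to `t (N + 1)`; `E` is the product of the others. -/
theorem exists_descProd_eq (hcomm : ∀ i j, i + 1 < j → t i * t j = t j * t i)
    {N r : ℕ} (hr : r + 1 ≤ N + 1) :
    ∃ E, descProd t (N + 1) (r + 1) = t N * E ∧ E * t (N + 1) = t (N + 1) * E := by
  induction r with
  | zero => exact ⟨1, by simp [descProd], by simp⟩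
  | succ r ih =>
    obtain ⟨E, h1, h2⟩ := ih (by omega)
    refine ⟨E * t (N + 1 - (r + 1 + 1)), ?_, ?_⟩
    · rw [descProd, h1, mul_assoc]
    · rw [mul_assoc, hcomm _ (N + 1) (by omega), ← mul_assoc, h2, mul_assoc]

theorem mul_descProd_mul (hcomm : ∀ i j, i + 1 < j → t i * t j = t j * t i)
    (hbraid : ∀ i, t i * t (i + 1) * t i = t (i + 1) * t i * t (i + 1))
    {N r : ℕ} (hr : r + 1 ≤ N + 1) :
    t (N + 1) * descProd t (N + 1) (r + 1) * t (N + 1) =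
      t N * (t (N + 1) * descProd t (N + 1) (r + 1)) := by
  obtain ⟨E, h1, h2⟩ := exists_descProd_eq hcomm hr
  calc _ = t (N + 1) * t N * (E * t (N + 1)) := by rw [h1]; simp only [mul_assoc]
    _ = t (N + 1) * t N * t (N + 1) * E := by rw [h2]; simp only [mul_assoc]
    _ = _ := by rw [← hbraid, h1]; simp only [mul_assoc]

/-- Two braid moves bring two copies of `t N` together. This is why `T_n` annihilates a standard
word with nonempty tail once the power of `T_n` is at least two. -/
theorem sq_mul_descProd_mul (hcomm : ∀ i j, i + 1 < j → t i * t j = t j * t i)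
    (hbraid : ∀ i, t i * t (i + 1) * t i = t (i + 1) * t i * t (i + 1))
    {N r : ℕ} (hr : r + 1 ≤ N + 1) (hsq : t N * t N = 0) :
    t (N + 1) ^ 2 * descProd t (N + 1) (r + 1) * t (N + 1) = 0 := by
  obtain ⟨E, h1, h2⟩ := exists_descProd_eq hcomm hr
  calc _ = t (N + 1) * (t (N + 1) * descProd t (N + 1) (r + 1) * t (N + 1)) := by
        rw [pow_two]; simp only [mul_assoc]
    _ = t (N + 1) * t N * t (N + 1) * (t N * E) := by
        rw [mul_descProd_mul hcomm hbraid hr, h1]; simp only [mul_assoc]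
    _ = t N * t (N + 1) * (t N * t N) * E := by
        rw [← hbraid]; simp only [mul_assoc]
    _ = 0 := by rw [hsq]; simp

end Desc

/-! ### The normal form -/

theorem NilA.Tw_eq_word (R : Type*) [CommRing R] {n : ℕ} {w : Equiv.Perm (Fin n)}
    {ω : List (Fin (n - 1))} (h : IsReducedWord ω w) :
    NilA.Tw R w = GenNilCoxeter.word R _ _ ω :=
  (isReducedWord_reducedWord w).prod_eq (fun _ _ ↦ GenNilCoxeter.T_comm)
    (fun _ _ ↦ GenNilCoxeter.T_braid) h

namespace NCA

section

variable (R : Type*) [CommRing R] {n : ℕ} (d : ℕ)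

theorem Tw_eq_word {w : Equiv.Perm (Fin n)} {ω : List (Fin (n - 1))} (h : IsReducedWord ω w) :
    Tw R d w = word R n d (ω.map (incl n)) := by
  have := (isReducedWord_reducedWord w).prod_eq (t := fun i ↦ T R n d (incl n i))
    (fun _ _ h ↦ GenNilCoxeter.T_comm h) (fun _ _ h ↦ GenNilCoxeter.T_braid h) h
  simp only [Tw, word, GenNilCoxeter.word, List.map_map]
  exact this

theorem T_sq {i : Fin n} (h : (i : ℕ) + 1 < n) : T R n d i * T R n d i = 0 := by
  have := GenNilCoxeter.T_pow (R := R) (M := CoxeterMatrix.A n) (e := orderA n d) i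
  rwa [orderA, if_neg (by omega), pow_two] at this

theorem Tw_mul_T {w : Equiv.Perm (Fin n)} {j : Fin (n - 1)} (h : IsAscent w j) :
    Tw R d w * T R n d (incl n j) = Tw R d (w * adjSwap n j) := by
  rw [Tw_eq_word R d (isReducedWord_reducedWord w),
    Tw_eq_word R d (isReducedWord_concat h (isReducedWord_reducedWord w)), List.map_append,
    word, word, GenNilCoxeter.word_append]
  simp [GenNilCoxeter.word, T]

/-- At a descent `w` has a reduced word ending in `j`, so a square appears. -/
theorem Tw_mul_T_of_not {w : Equiv.Perm (Fin n)} {j : Fin (n - 1)} (h : ¬ IsAscent w j) :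
    Tw R d w * T R n d (incl n j) = 0 := by
  have h1 := Tw_mul_T R d ((isAscent_mul_adjSwap w j).2 h)
  rw [mul_adjSwap_cancel] at h1
  rw [← h1, mul_assoc, T_sq R d (by simp only [incl, Fin.val_castLE]; omega), mul_zero]

/-- The generators, indexed by natural numbers and extended by zero. -/
def tNat (R : Type*) [CommRing R] (n d i : ℕ) : NCA R n d :=
  if h : i < n then T R n d ⟨i, h⟩ else 0

theorem tNat_val (i : Fin n) : tNat R n d i = T R n d i := dif_pos i.isLt

theorem tNat_comm (i j : ℕ) (h : i + 1 < j) :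
    tNat R n d i * tNat R n d j = tNat R n d j * tNat R n d i := by
  by_cases hj : j < n
  · rw [tNat, tNat, dif_pos hj, dif_pos (by omega)]
    exact GenNilCoxeter.T_comm h
  · rw [tNat, tNat, dif_neg hj, mul_zero, zero_mul]

theorem tNat_braid (i : ℕ) :
    tNat R n d i * tNat R n d (i + 1) * tNat R n d i =
      tNat R n d (i + 1) * tNat R n d i * tNat R n d (i + 1) := by
  by_cases hj : i + 1 < n
  · rw [tNat, tNat, dif_pos hj, dif_pos (by omega)]
    exact GenNilCoxeter.T_braid rfl
  · rw [tNat, tNat, dif_neg hj]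
    simp

theorem tNat_sq {i : ℕ} (h : i + 1 < n) : tNat R n d i * tNat R n d i = 0 := by
  rw [tNat, dif_pos (by omega)]
  exact T_sq R d h

theorem descLetters_self (n : ℕ) : descLetters n n = [] := by
  rw [descLetters, List.reverse_eq_nil_iff, List.filter_eq_nil_iff]
  intro i _
  simp only [decide_eq_true_eq]
  omega

theorem descLetters_succ {n m : ℕ} (h : m + 1 < n) :
    descLetters n (m + 1) = descLetters n (m + 2) ++ [⟨m, by omega⟩] := by
  rw [descLetters, descLetters, ← List.reverse_reverse [_], ← List.reverse_append]
  congr 1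
  -- Before reversal both lists are strictly increasing, so it suffices to compare their members.
  refine List.Pairwise.eq_of_mem_iff (r := (· < ·)) ((List.pairwise_lt_finRange n).filter _) ?_ ?_
  · simp only [List.reverse_singleton, List.singleton_append, List.pairwise_cons,
      List.mem_filter, decide_eq_true_eq]
    refine ⟨fun i hi ↦ ?_, (List.pairwise_lt_finRange n).filter _⟩
    rw [Fin.lt_def]
    simp only
    omega
  · intro i
    simp only [List.mem_filter, List.mem_finRange, true_and, decide_eq_true_eq,
      List.reverse_singleton, List.singleton_append, List.mem_cons, Fin.ext_iff]
    omega

theorem word_descLetters {r : ℕ} (h : r + 1 ≤ n) :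
    word R n d (descLetters n (n - r)) = descProd (tNat R n d) (n - 1) r := by
  induction r with
  | zero => rw [Nat.sub_zero, descLetters_self]; rfl
  | succ r ih =>
    obtain ⟨m, rfl⟩ : ∃ m, n = m + 2 + r := ⟨n - 2 - r, by omega⟩
    have e1 : m + 2 + r - (r + 1) = m + 1 := by omega
    have e2 : m + 2 + r - r = m + 2 := by omega
    have e3 : m + 2 + r - 1 - (r + 1) = m := by omega
    rw [e1, descLetters_succ (by omega), descProd, ← ih (by omega), e2, e3, word, word,
      GenNilCoxeter.word_append, GenNilCoxeter.word_singleton, tNat, dif_pos (by omega)]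
    rfl

theorem length_descLetters {n r : ℕ} (h : r + 1 ≤ n) : (descLetters n (n - r)).length = r := by
  induction r with
  | zero => rw [Nat.sub_zero, descLetters_self]; rfl
  | succ r ih =>
    obtain ⟨m, rfl⟩ : ∃ m, n = m + 2 + r := ⟨n - 2 - r, by omega⟩
    have e1 : m + 2 + r - (r + 1) = m + 1 := by omega
    have e2 : m + 2 + r - r = m + 2 := by omega
    have := ih (by omega)
    rw [e2] at this
    rw [e1, descLetters_succ (by omega), List.length_append, this, List.length_singleton]

theorem stdWord_eq (hn : 1 ≤ n) (w : Equiv.Perm (Fin n)) (k : ℕ) {r : ℕ} (h : r + 1 ≤ n) :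
    stdWord R d hn w k (n - r) =
      Tw R d w * tNat R n d (n - 1) ^ k * descProd (tNat R n d) (n - 1) r := by
  rw [stdWord, word_descLetters R d h, tNat, dif_pos (by omega)]

/-- A word is zero, or of one of the two standard forms; the number of letters is recorded by the
standard form. -/
def IsNormal (hn : 1 ≤ n) (x : NCA R n d) (l : ℕ) : Prop :=
  x = 0 ∨ (∃ w, x = Tw R d w ∧ l = permLength w) ∨
    ∃ w k r, 1 ≤ k ∧ k ≤ d - 1 ∧ r + 1 ≤ n ∧ x = stdWord R d hn w k (n - r) ∧
      l = permLength w + k + r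

theorem IsNormal.mul_T {R : Type*} [CommRing R] {n d : ℕ} {hn : 1 ≤ n} (hd : 2 ≤ d)
    {x : NCA R n d} {l : ℕ} (h : IsNormal R d hn x l) (j : Fin n) :
    IsNormal R d hn (x * T R n d j) (l + 1) := by
  obtain ⟨N, rfl⟩ : ∃ N, n = N + 1 := ⟨n - 1, by omega⟩
  have hc := tNat_comm R (n := N + 1) d
  have hb := tNat_braid R (n := N + 1) d
  have hincl : ∀ i (hi : i < N), tNat R (N + 1) d i = T R (N + 1) d (incl (N + 1) ⟨i, hi⟩) :=
    fun i hi ↦ tNat_val R d (incl (N + 1) ⟨i, hi⟩)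
  -- Common end of several cases: a generator other than the last has reached `T_w`, which absorbs
  -- it at an ascent and is annihilated at a descent.
  have hmove : ∀ (w : Equiv.Perm (Fin (N + 1))) (i : ℕ) (_ : i < N) (k r : ℕ), 1 ≤ k →
      k ≤ d - 1 → r + 1 ≤ N + 1 →
      IsNormal R d hn (Tw R d w * tNat R (N + 1) d i *
        (tNat R (N + 1) d N ^ k * descProd (tNat R (N + 1) d) N r))
        (permLength w + k + r + 1) := by
    intro w i hi k r hk hk' hr
    rw [hincl i hi]
    by_cases ha : IsAscent w (⟨i, hi⟩ : Fin (N + 1 - 1))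
    · rw [Tw_mul_T R d ha]
      refine Or.inr (Or.inr ⟨_, k, r, hk, hk', hr, ?_, by rw [permLength_mul_adjSwap ha]; omega⟩)
      rw [stdWord_eq R d hn _ _ hr, ← mul_assoc]
      rfl
    · rw [Tw_mul_T_of_not R d ha, zero_mul]
      exact Or.inl rfl
  rcases h with rfl | ⟨w, rfl, rfl⟩ | ⟨w, k, r, hk, hk', hr, rfl, rfl⟩
  · exact Or.inl (zero_mul _)
  · by_cases hj : (j : ℕ) = N
    · refine Or.inr (Or.inr ⟨w, 1, 0, le_rfl, by omega, by omega, ?_, rfl⟩)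
      rw [stdWord_eq R d hn _ _ (by omega), ← tNat_val, hj, pow_one, descProd, mul_one]
      rfl
    · have hj' : (j : ℕ) < N := by omega
      rw [← tNat_val, hincl j hj']
      by_cases ha : IsAscent w (⟨j, hj'⟩ : Fin (N + 1 - 1))
      · rw [Tw_mul_T R d ha]
        exact Or.inr (Or.inl ⟨_, rfl, (permLength_mul_adjSwap ha).symm⟩)
      · rw [Tw_mul_T_of_not R d ha]
        exact Or.inl rfl
  · rw [stdWord_eq R d hn _ _ hr, ← tNat_val, Nat.add_sub_cancel]
    obtain ⟨j, hj⟩ := j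
    simp only
    have hpow : ∀ i, i + 1 < N → tNat R (N + 1) d N ^ k * tNat R (N + 1) d i =
        tNat R (N + 1) d i * tNat R (N + 1) d N ^ k := fun i hi ↦
      ((show Commute _ _ from hc i N hi).pow_right k).symm.eq
    -- With zero-based indices the tail runs from `N - 1` down to `N - r`. The cases are: `j` far
    -- below the tail, `j` extending it, `j = N`, `j` equal to its last letter, and `j` further
    -- inside it.
    rcases Nat.lt_or_ge (j + r + 1) N with h1 | h1
    · rw [mul_assoc, descProd_mul_of_lt hc h1, ← mul_assoc, mul_assoc (Tw R d w),
        hpow j (by omega), ← mul_assoc, mul_assoc]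
      exact hmove w j (by omega) k r hk hk' hr
    rcases Nat.eq_or_lt_of_le h1 with h1 | h1
    · refine Or.inr (Or.inr ⟨w, k, r + 1, hk, hk', by omega, ?_, rfl⟩)
      rw [stdWord_eq R d hn _ _ (by omega), descProd, Nat.add_sub_cancel, mul_assoc,
        show N - (r + 1) = j by omega]
    rcases Nat.eq_or_lt_of_le (show j ≤ N by omega) with rfl | h2
    · cases r with
      | zero =>
        rw [descProd, mul_one, mul_assoc, ← pow_succ]
        by_cases hkd : k + 1 = d
        · left
          have := GenNilCoxeter.T_pow (R := R) (M := CoxeterMatrix.A (j + 1))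
            (e := orderA (j + 1) d) ⟨j, hj⟩
          rw [orderA, if_pos rfl] at this
          rw [hkd, tNat, dif_pos hj, T, this, mul_zero]
        · refine Or.inr (Or.inr ⟨w, k + 1, 0, by omega, by omega, by omega, ?_, by omega⟩)
          rw [stdWord_eq R d hn _ _ (by omega), descProd, mul_one]
          rfl
      | succ r =>
        obtain ⟨j, rfl⟩ : ∃ i, j = i + 1 := ⟨j - 1, by omega⟩
        obtain ⟨k, rfl⟩ : ∃ i, k = i + 1 := ⟨k - 1, by omega⟩
        cases k with
        | zero =>
          have h3 := hmove w j (by omega) 1 (r + 1) le_rfl (by omega) (by omega)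
          rw [pow_one, mul_assoc, ← mul_descProd_mul hc hb (by omega), ← mul_assoc,
            ← mul_assoc] at h3
          rw [zero_add, pow_one]
          exact h3
        | succ k =>
          left
          have h3 := sq_mul_descProd_mul (t := tNat R (j + 1 + 1) d) hc hb (N := j) (r := r)
            (by omega) (tNat_sq R d (by omega))
          rw [show k + 1 + 1 = k + 2 from rfl, pow_add, mul_assoc, mul_assoc, mul_assoc,
            ← mul_assoc (tNat R (j + 1 + 1) d (j + 1) ^ 2), h3, mul_zero, mul_zero]
    · rcases Nat.eq_or_lt_of_le (show N ≤ j + r by omega) with h3 | h3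
      · obtain ⟨r, rfl⟩ : ∃ i, r = i + 1 := ⟨r - 1, by omega⟩
        left
        have e1 : N - (r + 1) = j := by omega
        have h4 := descProd_mul_self (t := tNat R (N + 1) d) (N := N) (r := r)
          (by rw [e1]; exact tNat_sq R d (by omega))
        rw [e1] at h4
        rw [mul_assoc, h4, mul_zero]
      · obtain ⟨j, rfl⟩ : ∃ i, j = i + 1 := ⟨j - 1, by omega⟩
        rw [mul_assoc, descProd_mul_of_gt hc hb (by omega) h2 (by omega), ← mul_assoc,
          mul_assoc (Tw R d w), hpow j h2, ← mul_assoc, mul_assoc]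
        exact hmove w j (by omega) k r hk hk' hr

theorem Tw_one : Tw R d (1 : Equiv.Perm (Fin n)) = 1 := by
  rw [Tw_eq_word R d isReducedWord_nil]
  rfl

theorem permLength_one {n : ℕ} : permLength (1 : Equiv.Perm (Fin n)) = 0 :=
  isReducedWord_nil.2.symm

theorem isNormal_word (hn : 1 ≤ n) (hd : 2 ≤ d) (ω : List (Fin n)) :
    IsNormal R d hn (word R n d ω) ω.length := by
  induction ω using List.reverseRecOn with
  | nil => exact Or.inr (Or.inl ⟨1, (Tw_one R d).symm, permLength_one.symm⟩)
  | append_singleton ω j ih =>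
    have := ih.mul_T hd j
    rwa [List.length_append, List.length_singleton, word, GenNilCoxeter.word_append,
      GenNilCoxeter.word_singleton]

end

end NCA

/-! ### A representation on sequences

The states are pairs `(x, r)` of a sequence `x` and a natural number `r`. A generator `T_j` with
`j < n` sorts the entries `j` and `j + 1` of `x` in descending order, if they are in ascending order,
and kills the state otherwise. So does `T_n` while `r = 0`, except that it increases `r`, as long
as `r + 2 < d`, if the top element stands at the left one of the two positions. -/

namespace NCA

/-- Swap the entries `j` and `j + 1` of a sequence. -/
def swapSeq {α : Type*} (x : ℕ → α) (j : ℕ) : ℕ → α := fun a ↦ x (Equiv.swap j (j + 1) a)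

section

variable {α : Type*} (x : ℕ → α)

theorem swapSeq_left (j : ℕ) : swapSeq x j j = x (j + 1) := by
  rw [swapSeq, Equiv.swap_apply_left]

theorem swapSeq_right (j : ℕ) : swapSeq x j (j + 1) = x j := by
  rw [swapSeq, Equiv.swap_apply_right]

theorem swapSeq_of_ne {j a : ℕ} (h1 : a ≠ j) (h2 : a ≠ j + 1) : swapSeq x j a = x a := by
  rw [swapSeq, Equiv.swap_apply_of_ne_of_ne h1 h2]

theorem swapSeq_comm {i j : ℕ} (h : i + 1 < j) :
    swapSeq (swapSeq x i) j = swapSeq (swapSeq x j) i := by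
  funext a
  simp only [swapSeq, Equiv.swap_apply_def]
  congr 1
  split_ifs <;> omega

theorem swapSeq_braid (i : ℕ) : swapSeq (swapSeq (swapSeq x i) (i + 1)) i =
    swapSeq (swapSeq (swapSeq x (i + 1)) i) (i + 1) := by
  funext a
  simp only [swapSeq, ← Equiv.Perm.mul_apply]
  have h1 := Equiv.swap_mul_swap_mul_swap (x := i + 1 + 1) (y := i + 1) (z := i) (by omega)
    (by omega)
  have h2 := Equiv.swap_mul_swap_mul_swap (x := i) (y := i + 1) (z := i + 1 + 1) (by omega)
    (by omega)
  rw [Equiv.swap_comm (i + 1) i, Equiv.swap_comm (i + 1 + 1) (i + 1), mul_assoc] at h1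
  rw [Equiv.swap_comm (i + 1 + 1) i, mul_assoc] at h2
  rw [h1, h2]

end

section

variable {α : Type*} [LinearOrder α] [OrderTop α] (N d : ℕ)

/-- The action of the generator with index `j` on states, the one with index `N` being the last. -/
def step (j : ℕ) (s : (ℕ → α) × ℕ) : Option ((ℕ → α) × ℕ) :=
  if j = N ∧ s.1 j = ⊤ then
    if s.2 + 2 < d then some (s.1, s.2 + 1) else none
  else if (j = N → s.2 = 0) ∧ s.1 j < s.1 (j + 1) then some (swapSeq s.1 j, s.2) else none

variable {N d}

theorem step_of_ne {j : ℕ} (hj : j ≠ N) (x : ℕ → α) (r : ℕ) :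
    step N d j (x, r) = if x j < x (j + 1) then some (swapSeq x j, r) else none := by
  simp [step, hj]

theorem step_last_of_top {x : ℕ → α} (h : x N = ⊤) (r : ℕ) :
    step N d N (x, r) = if r + 2 < d then some (x, r + 1) else none := by
  simp [step, h]

theorem step_last_of_ne {x : ℕ → α} (h : x N ≠ ⊤) (r : ℕ) :
    step N d N (x, r) = if r = 0 ∧ x N < x (N + 1) then some (swapSeq x N, r) else none := by
  simp [step, h]

theorem step_comm {i j : ℕ} (h : i + 1 < j) (hj : j ≤ N) (s : (ℕ → α) × ℕ) :
    (step N d i s).bind (step N d j) = (step N d j s).bind (step N d i) := by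
  obtain ⟨x, r⟩ := s
  have hi : i ≠ N := by omega
  have h1 : swapSeq x i j = x j := swapSeq_of_ne x (by omega) (by omega)
  have h2 : swapSeq x i (j + 1) = x (j + 1) := swapSeq_of_ne x (by omega) (by omega)
  have h3 : swapSeq x j i = x i := swapSeq_of_ne x (by omega) (by omega)
  have h4 : swapSeq x j (i + 1) = x (i + 1) := swapSeq_of_ne x (by omega) (by omega)
  by_cases hx : x i < x (i + 1) <;> simp only [step_of_ne hi, hx, if_true, if_false,
    Option.bind_some, Option.bind_none]
  · simp only [step, h1, h2]
    split_ifs <;> simp_all [swapSeq_comm x h]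
  · simp only [step]
    split_ifs <;> simp_all

theorem step_sq {j : ℕ} (hj : j ≠ N) (s : (ℕ → α) × ℕ) :
    (step N d j s).bind (step N d j) = none := by
  obtain ⟨x, r⟩ := s
  rw [step_of_ne hj]
  split_ifs with h
  · rw [Option.bind_some, step_of_ne hj, swapSeq_left, swapSeq_right, if_neg h.asymm]
  · rfl

/-- Both sides reverse three increasing entries and kill every other state. The condition that the
counter be `0` is what makes this true when `⊤` already stands at position `N`. -/
theorem step_braid {i : ℕ} (hi : i + 1 ≤ N) (s : (ℕ → α) × ℕ) :
    ((step N d i s).bind (step N d (i + 1))).bind (step N d i) =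
      ((step N d (i + 1) s).bind (step N d i)).bind (step N d (i + 1)) := by
  obtain ⟨x, r⟩ := s
  have hi' : i ≠ N := by omega
  have e1 : ∀ y : ℕ → α, swapSeq y i (i + 2) = y (i + 2) := fun y ↦
    swapSeq_of_ne y (by omega) (by omega)
  have e2 : ∀ y : ℕ → α, swapSeq y (i + 1) i = y i := fun y ↦
    swapSeq_of_ne y (by omega) (by omega)
  have e3 : ∀ y : ℕ → α, swapSeq y (i + 1) (i + 2) = y (i + 1) := fun y ↦
    swapSeq_right y (i + 1)
  have e4 : ∀ y : ℕ → α, swapSeq y (i + 1) (i + 1) = y (i + 2) := fun y ↦ swapSeq_left y (i + 1)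
  have hb := swapSeq_braid x i
  -- One formula for the last and the other generators: away from `⊤` they differ only in the
  -- condition on the counter.
  have hs : ∀ (y : ℕ → α) (r : ℕ), y (i + 1) ≠ ⊤ → step N d (i + 1) (y, r) =
      if (i + 1 = N → r = 0) ∧ y (i + 1) < y (i + 2) then some (swapSeq y (i + 1), r)
        else none := fun y r h ↦ by simp [step, h]
  have hl : ((step N d i (x, r)).bind (step N d (i + 1))).bind (step N d i) =
      if (i + 1 = N → r = 0) ∧ x i < x (i + 1) ∧ x (i + 1) < x (i + 2) then
        some (swapSeq (swapSeq (swapSeq x i) (i + 1)) i, r) else none := by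
    rw [step_of_ne hi']
    by_cases h1 : x i < x (i + 1)
    · rw [if_pos h1, Option.bind_some, hs _ _ (by rw [swapSeq_right]; exact h1.ne_top),
        swapSeq_right, e1]
      by_cases h2 : (i + 1 = N → r = 0) ∧ x i < x (i + 2)
      · rw [if_pos h2, Option.bind_some, step_of_ne hi', e2, swapSeq_left, e4, e1]
        simp only [h1, true_and]
        exact if_congr ⟨fun h ↦ ⟨h2.1, h⟩, fun h ↦ h.2⟩ rfl rfl
      · rw [if_neg h2, if_neg]
        · rfl
        · exact fun h ↦ h2 ⟨h.1, h1.trans h.2.2⟩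
    · rw [if_neg h1, if_neg (fun h ↦ h1 h.2.1)]
      rfl
  rw [hl]
  by_cases htop : x (i + 1) = ⊤
  · rw [if_neg (fun h ↦ h.2.2.ne_top htop)]
    symm
    by_cases hN : i + 1 = N
    · subst hN
      rw [step_last_of_top htop]
      split_ifs with h1
      · rw [Option.bind_some, step_of_ne hi']
        split_ifs with h2
        -- The counter is now `r + 1`, and `⊤` has left position `N`, so the last generator kills
        -- the state.
        · rw [Option.bind_some, hs _ _ (by rw [swapSeq_right]; exact h2.ne_top), if_neg]
          simp
        · rfl
      · rfl
    · rw [step_of_ne hN, if_neg]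
      · rfl
      · rw [htop]; exact not_top_lt
  · rw [hs _ _ htop]
    by_cases h1 : (i + 1 = N → r = 0) ∧ x (i + 1) < x (i + 2)
    · rw [if_pos h1, Option.bind_some, step_of_ne hi', e2, e4]
      by_cases h2 : x i < x (i + 2)
      · rw [if_pos h2, Option.bind_some, hs _ _ (by rw [swapSeq_right, e2]; exact h2.ne_top),
          swapSeq_right, e2, e1, e3, hb]
        exact if_congr ⟨fun h ↦ ⟨h.1, h.2.1⟩, fun h ↦ ⟨h.1, h.2, h1.2⟩⟩ rfl rfl
      · rw [if_neg h2, if_neg (fun h ↦ h2 (h.2.1.trans h.2.2))]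
        rfl
    · rw [if_neg h1, if_neg (fun h ↦ h1 ⟨h.1, h.2.2⟩)]
      rfl

/-- The action of a word on states. -/
def run (N d : ℕ) (ω : List ℕ) (s : (ℕ → α) × ℕ) : Option ((ℕ → α) × ℕ) :=
  ω.foldlM (fun s j ↦ step N d j s) s

theorem run_append (ω ω' : List ℕ) (s : (ℕ → α) × ℕ) :
    run N d (ω ++ ω') s = (run N d ω s).bind (run N d ω') := by
  rw [run, List.foldlM_append]
  rfl

theorem run_cons (j : ℕ) (ω : List ℕ) (s : (ℕ → α) × ℕ) :
    run N d (j :: ω) s = (step N d j s).bind (run N d ω) := by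
  rw [run, List.foldlM_cons]
  rfl

theorem run_singleton (j : ℕ) (s : (ℕ → α) × ℕ) : run N d [j] s = step N d j s := by
  simp [run]

/-- Only the last of the `k` steps matters for survival: it starts from the counter `r + k - 1`. -/
theorem run_replicate_of_top {x : ℕ → α} (h : x N = ⊤) (k r : ℕ) :
    run N d (List.replicate k N) (x, r) =
      if k = 0 ∨ r + k + 1 < d then some (x, r + k) else none := by
  induction k generalizing r with
  | zero => simp [run]
  | succ k ih =>
    rw [List.replicate_succ, run_cons, step_last_of_top h]
    by_cases h1 : r + 2 < d
    · rw [if_pos h1, Option.bind_some, ih, add_right_comm r 1 k]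
      exact if_congr (by omega) rfl rfl
    · rw [if_neg h1, if_neg (by omega)]
      rfl

/-- If `⊤` is at position `N`, at once or after the first letter, at least `d - 1` letters remain
and overrun the counter. Otherwise the second letter, present since `2 ≤ d`, meets a descent. -/
theorem run_replicate_last (hd : 2 ≤ d) (s : (ℕ → α) × ℕ) :
    run N d (List.replicate d N) s = none := by
  obtain ⟨x, r⟩ := s
  by_cases hx : x N = ⊤
  · rw [run_replicate_of_top hx, if_neg (by omega)]
  · obtain ⟨e, rfl⟩ : ∃ e, d = e + 2 := ⟨d - 2, by omega⟩
    rw [List.replicate_succ, run_cons, step_last_of_ne hx]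
    split_ifs with h
    · rw [Option.bind_some]
      by_cases hy : swapSeq x N N = ⊤
      · rw [run_replicate_of_top hy, if_neg (by omega)]
      · rw [List.replicate_succ, run_cons, step_last_of_ne hy, swapSeq_left, swapSeq_right,
          if_neg (fun h' ↦ h.2.asymm h'.2)]
        rfl
    · rfl

end

end NCA

/-! ### The linear representation on functions of states -/

namespace NCA

section

variable (R : Type*) [CommRing R] {α : Type*} [LinearOrder α] [OrderTop α] (N d : ℕ)

/-- The operator on functions of states which is given by pulling back along `step`. -/
def stepOp (j : ℕ) : Module.End R ((ℕ → α) × ℕ → R) where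
  toFun f := fun s ↦ (step N d j s).elim 0 f
  map_add' f g := by
    funext s
    cases h : step N d j s <;> simp [h]
  map_smul' c f := by
    funext s
    cases h : step N d j s <;> simp [h]

variable {R N d}

theorem stepOp_apply (j : ℕ) (f : (ℕ → α) × ℕ → R) (s : (ℕ → α) × ℕ) :
    stepOp R N d j f s = (step N d j s).elim 0 f := rfl

/-- Pulling back reverses composition, so the leftmost letter acts first on states. -/
theorem prod_stepOp_apply (ω : List ℕ) (f : (ℕ → α) × ℕ → R) (s : (ℕ → α) × ℕ) :
    (ω.map (stepOp R N d)).prod f s = (run N d ω s).elim 0 f := by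
  induction ω generalizing s with
  | nil => rfl
  | cons j ω ih =>
    rw [List.map_cons, List.prod_cons, Module.End.mul_apply, stepOp_apply, run_cons]
    cases step N d j s with
    | none => rfl
    | some s' => exact ih s'

theorem prod_stepOp_congr {ω ω' : List ℕ}
    (h : ∀ s : (ℕ → α) × ℕ, run N d ω s = run N d ω' s) :
    (ω.map (stepOp (α := α) R N d)).prod = (ω'.map (stepOp R N d)).prod := by
  apply LinearMap.ext
  intro f
  funext s
  rw [prod_stepOp_apply, prod_stepOp_apply, h]

theorem prod_stepOp_eq_zero {ω : List ℕ}
    (h : ∀ s : (ℕ → α) × ℕ, run N d ω s = none) :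
    (ω.map (stepOp (α := α) R N d)).prod = 0 := by
  apply LinearMap.ext
  intro f
  funext s
  rw [prod_stepOp_apply, h]
  rfl

end

section

variable (R : Type*) [CommRing R] (α : Type*) [LinearOrder α] [OrderTop α] (n : ℕ) {d : ℕ}

/-- The representation of `NC_A(n,d)` on functions of states. -/
def stepRep (hd : 2 ≤ d) : NCA R n d →ₐ[R] Module.End R ((ℕ → α) × ℕ → R) :=
  GenNilCoxeter.liftA (fun j ↦ stepOp R (n - 1) d j)
    (fun i j h ↦ by
      have := prod_stepOp_congr (R := R) (N := n - 1) (d := d) (α := α)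
        (ω := [(i : ℕ), j]) (ω' := [(j : ℕ), i]) fun s ↦ by
          simpa [run_cons, run] using step_comm (α := α) h (by omega) s
      simpa only [List.map_cons, List.map_nil, List.prod_cons, List.prod_nil, mul_one] using this)
    (fun i j h ↦ by
      rw [h]
      have := prod_stepOp_congr (R := R) (N := n - 1) (d := d) (α := α)
        (ω := [(i : ℕ), i + 1, i]) (ω' := [(i : ℕ) + 1, i, i + 1]) fun s ↦ by
          simpa [run_cons, run, Option.bind_assoc] using step_braid (α := α) (by omega) s
      simpa only [List.map_cons, List.map_nil, List.prod_cons, List.prod_nil, mul_one,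
        mul_assoc] using this)
    (fun i ↦ by
      by_cases h : (i : ℕ) + 1 = n
      · rw [orderA, if_pos h, show (i : ℕ) = n - 1 by omega]
        have := prod_stepOp_eq_zero (R := R) (α := α) (run_replicate_last (N := n - 1) hd)
        simpa only [List.map_replicate, List.prod_replicate] using this
      · rw [orderA, if_neg h]
        have hi : (i : ℕ) ≠ n - 1 := by omega
        have := prod_stepOp_eq_zero (R := R) (ω := [(i : ℕ), i]) fun s ↦ by
          simpa [run_cons, run] using step_sq (α := α) (d := d) hi s
        simpa only [List.map_cons, List.map_nil, List.prod_cons, List.prod_nil, mul_one,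
          pow_two] using this)

variable {R n}

theorem stepRep_word (hd : 2 ≤ d) (ω : List (Fin n)) :
    stepRep R α n hd (word R n d ω) =
      ((ω.map Fin.val).map (stepOp R (n - 1) d)).prod := by
  rw [word, GenNilCoxeter.map_word, List.map_map]
  congr 2
  funext i
  exact GenNilCoxeter.liftA_T _ _ _ _ i

variable {α}

theorem word_ne_zero_of_run [Nontrivial R] (hd : 2 ≤ d) {ω : List (Fin n)}
    {s s' : (ℕ → α) × ℕ} (h : run (n - 1) d (ω.map Fin.val) s = some s') :
    word R n d ω ≠ 0 := by
  intro h0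
  have h1 := congrArg (stepRep R α n hd) h0
  rw [stepRep_word, map_zero] at h1
  have h2 := congrFun (LinearMap.congr_fun h1 fun _ ↦ 1) s
  rw [prod_stepOp_apply, h] at h2
  exact one_ne_zero h2

end

/-! ### Nonvanishing of the standard words -/

section

variable {n d : ℕ}

/-- The one-line notation of a permutation, continued by the top element. -/
def seqOf (w : Equiv.Perm (Fin n)) (a : ℕ) : WithTop (Fin n) :=
  if h : a < n then (w ⟨a, h⟩ : WithTop (Fin n)) else ⊤

theorem seqOf_mul_adjSwap (w : Equiv.Perm (Fin n)) (j : Fin (n - 1)) :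
    seqOf (w * adjSwap n j) = swapSeq (seqOf w) j := by
  funext a
  rw [swapSeq, seqOf, seqOf]
  have hlt : Equiv.swap (j : ℕ) (j + 1) a < n ↔ a < n := by
    rw [Equiv.swap_apply_def]
    split_ifs <;> omega
  by_cases h : a < n
  · rw [dif_pos h, dif_pos (hlt.2 h), Equiv.Perm.mul_apply]
    congr 2
    apply Fin.ext
    rw [adjSwap_val]
    exact (Equiv.swap_apply_def _ _ _).symm
  · rw [dif_neg h, dif_neg (fun h' ↦ h (hlt.1 h'))]

/-- Each letter of a reduced word meets an ascent of the permutation built so far, so no step kills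
the state. -/
theorem run_reducedWord {w : Equiv.Perm (Fin n)} {ω : List (Fin (n - 1))}
    (h : IsReducedWord ω w) :
    run (n - 1) d ((ω.map (incl n)).map Fin.val) (seqOf (1 : Equiv.Perm (Fin n)), 0) =
      some (seqOf w, 0) := by
  induction ω using List.reverseRecOn generalizing w with
  | nil =>
    obtain rfl : 1 = w := by simpa [permProd] using h.1
    rfl
  | append_singleton ω j ih =>
    obtain ⟨hj, hω⟩ := h.of_concat
    have hN : (j : ℕ) ≠ n - 1 := by omega
    have hlt : seqOf (w * adjSwap n j) j < seqOf (w * adjSwap n j) (j + 1) := by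
      rw [seqOf, seqOf, dif_pos (by omega), dif_pos (by omega), WithTop.coe_lt_coe]
      exact (isAscent_mul_adjSwap w j).2 hj
    rw [List.map_append, List.map_append, run_append, ih hω, Option.bind_some, List.map_singleton,
      List.map_singleton, run_singleton]
    change step (n - 1) d j _ = _
    rw [step_of_ne hN, if_pos hlt, ← seqOf_mul_adjSwap, mul_adjSwap_cancel]

theorem exists_run_descLetters {x : ℕ → WithTop (Fin n)} (hx : x (n - 1) = ⊤)
    (hx' : ∀ a < n - 1, x a ≠ ⊤) (k : ℕ) {r : ℕ} (hr : r + 1 ≤ n) :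
    ∃ y, run (n - 1) d ((descLetters n (n - r)).map Fin.val) (x, k) = some (y, k) ∧
      y (n - 1 - r) = ⊤ ∧ ∀ a < n - 1 - r, y a ≠ ⊤ := by
  induction r with
  | zero =>
    refine ⟨x, ?_, hx, hx'⟩
    rw [Nat.sub_zero, descLetters_self]
    rfl
  | succ r ih =>
    obtain ⟨m, rfl⟩ : ∃ m, n = m + 2 + r := ⟨n - 2 - r, by omega⟩
    obtain ⟨y, h1, h2, h3⟩ := ih (by omega)
    have e1 : m + 2 + r - (r + 1) = m + 1 := by omega
    have e2 : m + 2 + r - r = m + 2 := by omega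
    have e3 : m + 2 + r - 1 - r = m + 1 := by omega
    have e4 : m + 2 + r - 1 - (r + 1) = m := by omega
    rw [e2] at h1
    rw [e3] at h2 h3
    refine ⟨swapSeq y m, ?_, ?_, fun a ha ↦ ?_⟩
    · rw [e1, descLetters_succ (by omega), List.map_append, run_append, h1, Option.bind_some,
        List.map_singleton, run_singleton, step_of_ne (j := m) (by omega), if_pos]
      rw [h2]
      exact lt_top_iff_ne_top.2 (h3 m (by omega))
    · rw [e4, swapSeq_left, h2]
    · rw [e4] at ha
      rw [swapSeq_of_ne y (by omega) (by omega)]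
      exact h3 a (by omega)

/-- The letters of the word `T_w T_n^k T_{n-1} ⋯ T_m`. -/
noncomputable def stdLetters (hn : 1 ≤ n) (w : Equiv.Perm (Fin n)) (k m : ℕ) : List (Fin n) :=
  (reducedWord w).map (incl n) ++ List.replicate k ⟨n - 1, by omega⟩ ++ descLetters n m

theorem word_stdLetters (R : Type*) [CommRing R] (hn : 1 ≤ n) (w : Equiv.Perm (Fin n))
    (k m : ℕ) : word R n d (stdLetters hn w k m) = stdWord R d hn w k m := by
  rw [stdLetters, stdWord, word, GenNilCoxeter.word_append, GenNilCoxeter.word_append,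
    GenNilCoxeter.word_replicate]
  rfl

theorem length_stdLetters (hn : 1 ≤ n) (w : Equiv.Perm (Fin n)) (k : ℕ) {m : ℕ} (hm : 1 ≤ m)
    (hmn : m ≤ n) : (stdLetters hn w k m).length = permLength w + k + (n - m) := by
  have h := length_descLetters (n := n) (r := n - m) (by omega)
  rw [Nat.sub_sub_self hmn] at h
  rw [stdLetters, List.length_append, List.length_append, List.length_map, List.length_replicate,
    h, (isReducedWord_reducedWord w).2]

theorem stdWord_ne_zero (R : Type*) [CommRing R] [Nontrivial R] (hn : 1 ≤ n) (hd : 2 ≤ d)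
    (w : Equiv.Perm (Fin n)) {k m : ℕ} (hk : 1 ≤ k) (hkd : k ≤ d - 1) (hm : 1 ≤ m)
    (hmn : m ≤ n) : stdWord R d hn w k m ≠ 0 := by
  have hlast : seqOf w (n - 1) ≠ ⊤ := by
    rw [seqOf, dif_pos (by omega)]
    exact WithTop.coe_ne_top
  have htop : seqOf w (n - 1 + 1) = ⊤ := by
    rw [seqOf, dif_neg (by omega)]
  have h1 : step (n - 1) d (n - 1) (seqOf w, 0) = some (swapSeq (seqOf w) (n - 1), 0) := by
    rw [step_last_of_ne hlast, if_pos]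
    refine ⟨rfl, ?_⟩
    rw [htop]
    exact lt_top_iff_ne_top.2 hlast
  have h2 : swapSeq (seqOf w) (n - 1) (n - 1) = ⊤ := by rw [swapSeq_left, htop]
  -- The first `T_n` pulls `⊤` into position `n - 1` and leaves the counter at `0`; only the other
  -- `k - 1` copies raise it, which the bound `k ≤ d - 1` just permits.
  obtain ⟨k, rfl⟩ : ∃ i, k = i + 1 := ⟨k - 1, by omega⟩
  obtain ⟨y, hy, -, -⟩ := exists_run_descLetters (d := d) h2 (fun a ha ↦ by
    rw [swapSeq_of_ne _ (by omega) (by omega), seqOf, dif_pos (by omega)]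
    exact WithTop.coe_ne_top) k (r := n - m) (by omega)
  rw [Nat.sub_sub_self hmn] at hy
  rw [← word_stdLetters]
  refine word_ne_zero_of_run (α := WithTop (Fin n)) (s := (seqOf 1, 0)) (s' := (y, k)) hd ?_
  rw [stdLetters, List.map_append, List.map_append, run_append, run_append,
    run_reducedWord (isReducedWord_reducedWord w), Option.bind_some, List.map_replicate,
    List.replicate_succ, run_cons, h1, Option.bind_some, run_replicate_of_top h2,
    if_pos (by omega), Option.bind_some, zero_add, hy]

theorem Tw_ne_zero (R : Type*) [CommRing R] [Nontrivial R] (hd : 2 ≤ d)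
    (w : Equiv.Perm (Fin n)) : Tw R d w ≠ 0 :=
  word_ne_zero_of_run (α := WithTop (Fin n)) hd (run_reducedWord (isReducedWord_reducedWord w))

end

end NCA

/-! ### The length function -/

namespace GenNilCoxeter

section

variable {R : Type*} [CommRing R] {n : ℕ} {e : Fin n → ℕ}

/-- The grading by the number of letters, as an algebra map to polynomials. -/
noncomputable def gradeHom : GenNilCoxeter R (CoxeterMatrix.A n) e →ₐ[R]
    Polynomial (GenNilCoxeter R (CoxeterMatrix.A n) e) :=
  liftA (fun i ↦ Polynomial.monomial 1 (T R _ e i))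
    (fun i j h ↦ by
      rw [Polynomial.monomial_mul_monomial, Polynomial.monomial_mul_monomial, T_comm h])
    (fun i j h ↦ by
      simp only [Polynomial.monomial_mul_monomial]
      rw [T_braid h])
    (fun i ↦ by rw [Polynomial.monomial_pow, T_pow, map_zero])

theorem gradeHom_word (ω : List (Fin n)) :
    gradeHom (word R (CoxeterMatrix.A n) e ω) =
      Polynomial.monomial ω.length (word R (CoxeterMatrix.A n) e ω) := by
  induction ω with
  | nil => rw [word_nil, map_one]; rfl
  | cons i ω ih =>
    rw [← List.singleton_append, word_append, map_mul, ih, word_singleton, gradeHom, liftA_T,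
      Polynomial.monomial_mul_monomial, List.length_append, List.length_singleton]

/-- A nonzero monomial determines its degree. -/
theorem length_eq_of_word_eq {ω ω' : List (Fin n)}
    (h : word R (CoxeterMatrix.A n) e ω = word R (CoxeterMatrix.A n) e ω')
    (h0 : word R (CoxeterMatrix.A n) e ω ≠ 0) : ω.length = ω'.length := by
  have h1 := gradeHom_word (R := R) (e := e) ω
  rw [h, gradeHom_word] at h1
  by_contra hne
  have h2 := congrArg (fun p ↦ Polynomial.coeff p ω.length) h1
  simp only [Polynomial.coeff_monomial, if_true, if_neg (Ne.symm hne)] at h2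
  exact h0 (h.trans h2.symm)

/-- The length function of a generalized nil-Coxeter algebra of type `A`. -/
noncomputable def wordLength (x : NonzeroWord R (CoxeterMatrix.A n) e) : ℕ :=
  x.2.2.choose.length

theorem isLengthFunction_wordLength :
    IsLengthFunction R (CoxeterMatrix.A n) e wordLength := by
  intro ω h
  have h1 : ∃ ω' : List (Fin n), word R (CoxeterMatrix.A n) e ω' = word R _ e ω := ⟨ω, rfl⟩
  exact (length_eq_of_word_eq h1.choose_spec.symm h).symm

/-! ### The augmentation ideal, its powers and the units -/

/-- The augmentation, which sends all generators to zero. -/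
def augmentation (he : ∀ i, e i ≠ 0) : GenNilCoxeter R (CoxeterMatrix.A n) e →ₐ[R] R :=
  liftA (fun _ ↦ 0) (fun _ _ _ ↦ rfl) (fun _ _ _ ↦ rfl) (fun i ↦ zero_pow (he i))

theorem sub_algebraMap_mem (he : ∀ i, e i ≠ 0) (x : GenNilCoxeter R (CoxeterMatrix.A n) e) :
    x - algebraMap R _ (augmentation he x) ∈ maxIdeal R (CoxeterMatrix.A n) e ∧
      x - algebraMap R _ (augmentation he x) ∈ wordSpan R (CoxeterMatrix.A n) e 1 := by
  have hx : x ∈ Algebra.adjoin R (Set.range (T R (CoxeterMatrix.A n) e)) := by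
    rw [adjoin_range_T]
    exact Algebra.mem_top
  induction hx using Algebra.adjoin_induction with
  | mem x hx =>
    obtain ⟨i, rfl⟩ := hx
    rw [augmentation, liftA_T, map_zero, sub_zero]
    refine ⟨TwoSidedIdeal.subset_span ⟨i, rfl⟩, ?_⟩
    rw [← word_singleton]
    exact word_mem_wordSpan le_rfl
  | algebraMap r =>
    rw [AlgHom.commutes, Algebra.algebraMap_self_apply, sub_self]
    exact ⟨TwoSidedIdeal.zero_mem _, Submodule.zero_mem _⟩
  | add x y _ _ hx hy =>
    rw [map_add, map_add, add_sub_add_comm]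
    exact ⟨TwoSidedIdeal.add_mem _ hx.1 hy.1, Submodule.add_mem _ hx.2 hy.2⟩
  | mul x y _ _ hx hy =>
    have h : x * y - algebraMap R _ (augmentation he (x * y)) =
        x * (y - algebraMap R _ (augmentation he y)) +
          (x - algebraMap R _ (augmentation he x)) * algebraMap R _ (augmentation he y) := by
      rw [map_mul, map_mul, mul_sub, sub_mul, sub_add_sub_cancel]
    rw [h]
    refine ⟨TwoSidedIdeal.add_mem _ (TwoSidedIdeal.mul_mem_left _ _ _ hy.1)
      (TwoSidedIdeal.mul_mem_right _ _ _ hx.1), Submodule.add_mem _ ?_ ?_⟩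
    · simpa only [zero_add] using mul_mem_wordSpan (mem_wordSpan_zero x) hy.2
    · simpa only [add_zero] using mul_mem_wordSpan hx.2 (mem_wordSpan_zero _)

theorem mem_maxIdeal_iff (he : ∀ i, e i ≠ 0) (x : GenNilCoxeter R (CoxeterMatrix.A n) e) :
    x ∈ maxIdeal R (CoxeterMatrix.A n) e ↔ augmentation he x = 0 := by
  constructor
  · intro hx
    have h : maxIdeal R (CoxeterMatrix.A n) e ≤ TwoSidedIdeal.ker (augmentation (R := R) he) := by
      refine TwoSidedIdeal.span_le.2 ?_
      rintro _ ⟨i, rfl⟩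
      rw [SetLike.mem_coe, TwoSidedIdeal.mem_ker, augmentation, liftA_T]
    exact (TwoSidedIdeal.mem_ker _).1 (h hx)
  · intro hx
    have := (sub_algebraMap_mem he x).1
    rwa [hx, map_zero, sub_zero] at this

theorem maxIdeal_le_wordSpan (he : ∀ i, e i ≠ 0) {x : GenNilCoxeter R (CoxeterMatrix.A n) e}
    (hx : x ∈ maxIdeal R (CoxeterMatrix.A n) e) : x ∈ wordSpan R (CoxeterMatrix.A n) e 1 := by
  have := (sub_algebraMap_mem he x).2
  rwa [(mem_maxIdeal_iff he x).1 hx, map_zero, sub_zero] at this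

theorem maxIdeal_pow_le_wordSpan (he : ∀ i, e i ≠ 0) (k : ℕ)
    {x : GenNilCoxeter R (CoxeterMatrix.A n) e}
    (hx : x ∈ (maxIdeal R (CoxeterMatrix.A n) e).asIdeal ^ k) :
    x ∈ wordSpan R (CoxeterMatrix.A n) e k := by
  induction k generalizing x with
  | zero => exact mem_wordSpan_zero x
  | succ k ih =>
    rw [Submodule.pow_succ] at hx
    induction hx using Submodule.mul_induction_on' with
    | mem_mul_mem a ha b hb =>
      exact mul_mem_wordSpan (ih ha) (maxIdeal_le_wordSpan he hb)
    | add a _ b _ ha hb => exact Submodule.add_mem _ ha hb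

theorem wordSpan_eq_bot {k : ℕ} (h : ∀ ω : List (Fin n), k ≤ ω.length →
    word R (CoxeterMatrix.A n) e ω = 0) : wordSpan R (CoxeterMatrix.A n) e k = ⊥ := by
  rw [wordSpan, Submodule.span_eq_bot]
  rintro _ ⟨ω, hω, rfl⟩
  exact h ω hω

theorem isUnit_iff_of_wordSpan_eq_bot (hR : IsField R) (he : ∀ i, e i ≠ 0) {k : ℕ}
    (h : wordSpan R (CoxeterMatrix.A n) e k = ⊥) (x : GenNilCoxeter R (CoxeterMatrix.A n) e) :
    x ∈ maxIdeal R (CoxeterMatrix.A n) e ↔ ¬ IsUnit x := by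
  have := hR.nontrivial
  rw [mem_maxIdeal_iff he]
  constructor
  · intro h0 hu
    have := hu.map (augmentation (R := R) he)
    rw [h0] at this
    exact not_isUnit_zero this
  · intro hu
    by_contra h0
    apply hu
    obtain ⟨c, hc⟩ := hR.mul_inv_cancel h0
    have hun : IsUnit (algebraMap R (GenNilCoxeter R (CoxeterMatrix.A n) e)
        (augmentation he x)) := (IsUnit.of_mul_eq_one c hc).map _
    have hy : ∀ m, (x - algebraMap R _ (augmentation he x)) ^ m ∈
        wordSpan R (CoxeterMatrix.A n) e m := by
      intro m
      induction m with
      | zero => exact mem_wordSpan_zero _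
      | succ m ih =>
        rw [pow_succ]
        exact mul_mem_wordSpan ih (sub_algebraMap_mem he x).2
    -- An invertible scalar plus a nilpotent element is a unit, since scalars are central.
    have hnil : IsNilpotent (x - algebraMap R _ (augmentation he x)) := by
      have := hy k
      rw [h] at this
      exact ⟨k, (Submodule.mem_bot R).1 this⟩
    have := hnil.isUnit_add_left_of_commute hun (Algebra.commutes _ _).symm
    rwa [add_sub_cancel] at this

end

end GenNilCoxeter

/-! ### Rings whose nonunits form a two-sided ideal -/

section Local

variable {A : Type*} [Ring A] {m : TwoSidedIdeal A}

/-- The order-theoretic core shared by the statements on left, right and two-sided ideals. -/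
theorem isCoatom_iff_eq_of_forall_le {P : Type*} [PartialOrder P] [OrderTop P] {a : P}
    (ha : a ≠ ⊤) (h : ∀ b, b ≠ ⊤ → b ≤ a) (b : P) : IsCoatom b ↔ b = a := by
  have hc : IsCoatom a := ⟨ha, fun b hb ↦ by
    by_contra hne
    exact absurd (h b hne) (not_le_of_gt hb)⟩
  exact ⟨fun hb ↦ ((hb.le_iff_eq ha).1 (h b hb.1)).symm, fun hb ↦ hb ▸ hc⟩

theorem IsLocalRing.of_twoSidedIdeal (h : ∀ x, x ∈ m ↔ ¬ IsUnit x) : IsLocalRing A where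
  exists_pair_ne := ⟨0, 1, fun h01 ↦ by
    have h1 := m.zero_mem
    rw [h01, h] at h1
    exact h1 isUnit_one⟩
  isUnit_or_isUnit_of_add_one := fun {a b} hab ↦ by
    by_contra! hcon
    have h1 := m.add_mem ((h a).2 hcon.1) ((h b).2 hcon.2)
    rw [hab, h] at h1
    exact h1 isUnit_one

theorem TwoSidedIdeal.isCoatom_iff_eq (h : ∀ x, x ∈ m ↔ ¬ IsUnit x) (J : TwoSidedIdeal A) :
    IsCoatom J ↔ J = m := by
  refine isCoatom_iff_eq_of_forall_le (fun hm ↦ ?_) (fun J hJ x hx ↦ (h x).2 fun hu ↦ hJ ?_) J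
  · exact (h 1).1 (by rw [hm]; trivial) isUnit_one
  · obtain ⟨u, rfl⟩ := hu
    refine eq_top_iff.2 fun y _ ↦ ?_
    have := J.mul_mem_left (y * ↑u⁻¹) _ hx
    rwa [mul_assoc, Units.inv_mul, mul_one] at this

theorem Ideal.isMaximal_iff_coe_eq (h : ∀ x, x ∈ m ↔ ¬ IsUnit x) (J : Ideal A) :
    J.IsMaximal ↔ (J : Set A) = m := by
  rw [Ideal.isMaximal_def, isCoatom_iff_eq_of_forall_le (a := m.asIdeal) (fun hm ↦ ?_)
    (fun J hJ x hx ↦ (h x).2 fun hu ↦ hJ (J.eq_top_of_isUnit_mem hx hu)), ← SetLike.coe_set_eq]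
  · rfl
  · have : (1 : A) ∈ m.asIdeal := by rw [hm]; trivial
    exact (h 1).1 this isUnit_one

/-- A two-sided ideal as a right ideal. -/
def TwoSidedIdeal.asRightIdeal (m : TwoSidedIdeal A) : Submodule Aᵐᵒᵖ A where
  carrier := m
  add_mem' := m.add_mem
  zero_mem' := m.zero_mem
  smul_mem' c _ hx := m.mul_mem_right _ c.unop hx

theorem Submodule.isCoatom_iff_coe_eq (h : ∀ x, x ∈ m ↔ ¬ IsUnit x) (J : Submodule Aᵐᵒᵖ A) :
    IsCoatom J ↔ (J : Set A) = m := by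
  rw [isCoatom_iff_eq_of_forall_le (a := m.asRightIdeal) (fun hm ↦ ?_)
    (fun J hJ x hx ↦ (h x).2 fun hu ↦ hJ ?_), ← SetLike.coe_set_eq]
  · rfl
  · have : (1 : A) ∈ m.asRightIdeal := by rw [hm]; trivial
    exact (h 1).1 this isUnit_one
  · obtain ⟨u, rfl⟩ := hu
    refine eq_top_iff.2 fun y _ ↦ ?_
    have := J.smul_mem (MulOpposite.op (↑u⁻¹ * y)) hx
    rwa [op_smul_eq_mul, Units.mul_inv_cancel_left] at this

end Local

/-! ### The main theorem -/

namespace NCA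

section

variable (R : Type*) [CommRing R] (n d : ℕ)

theorem fromNilA_T (i : Fin (n - 1)) :
    fromNilA R n d (GenNilCoxeter.T R _ _ i) = T R n d (incl n i) := by
  simp [fromNilA, GenNilCoxeter.T]

theorem fromNilA_word (ω : List (Fin (n - 1))) :
    fromNilA R n d (GenNilCoxeter.word R _ _ ω) = word R n d (ω.map (incl n)) := by
  rw [GenNilCoxeter.map_word, word, GenNilCoxeter.word, List.map_map]
  congr 2
  funext i
  exact fromNilA_T R n d i

theorem range_fromNilA : (fromNilA R n d).range = subalgR R n d := by
  rw [← Algebra.map_top, ← GenNilCoxeter.adjoin_range_T, AlgHom.map_adjoin, ← Set.range_comp,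
    subalgR]
  congr 2
  funext i
  exact fromNilA_T R n d i

variable {d}

/-- The retraction of `NC_A(n,d)` onto the usual nil-Coxeter algebra, which kills `T_n`. -/
def toNilA (hd : 2 ≤ d) : NCA R n d →ₐ[R] NilA R n :=
  GenNilCoxeter.liftA
    (fun i ↦ if h : (i : ℕ) < n - 1 then GenNilCoxeter.T R _ _ ⟨i, h⟩ else 0)
    (fun i j h ↦ by
      by_cases hj : (j : ℕ) < n - 1
      · rw [dif_pos hj, dif_pos (by omega)]
        exact GenNilCoxeter.T_comm h
      · rw [dif_neg hj, mul_zero, zero_mul])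
    (fun i j h ↦ by
      by_cases hj : (j : ℕ) < n - 1
      · rw [dif_pos hj, dif_pos (by omega)]
        exact GenNilCoxeter.T_braid h
      · rw [dif_neg hj]
        simp)
    (fun i ↦ by
      by_cases hi : (i : ℕ) < n - 1
      · rw [dif_pos hi, orderA, if_neg (by omega)]
        exact GenNilCoxeter.T_pow _
      · rw [dif_neg hi, orderA, if_pos (by omega), zero_pow (by omega)])

/-- The retraction `toNilA` is a left inverse, as is checked on generators. -/
theorem fromNilA_injective (hd : 2 ≤ d) : Function.Injective (fromNilA R n d) := by
  have h : ((toNilA R n hd).comp (fromNilA R n d)) = AlgHom.id R (NilA R n) := by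
    refine AlgHom.ext_of_adjoin_eq_top GenNilCoxeter.adjoin_range_T ?_
    rintro _ ⟨i, rfl⟩
    rw [AlgHom.comp_apply, fromNilA_T, toNilA, T, GenNilCoxeter.liftA_T]
    exact dif_pos i.isLt
  intro x y hxy
  have hx := DFunLike.congr_fun h x
  have hy := DFunLike.congr_fun h y
  rw [AlgHom.comp_apply, AlgHom.id_apply] at hx hy
  rw [← hx, ← hy, hxy]

variable {R n}

theorem orderA_ne_zero (hd : 2 ≤ d) (i : Fin n) : orderA n d i ≠ 0 := by
  rw [orderA]
  split_ifs <;> omega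

/-- A standard word has at most `ℓ(w'_∘) + (d - 1) + (n - 1)` letters, so every longer word falls
into the zero case of the normal form. -/
theorem wordSpan_eq_bot (hn : 1 ≤ n) (hd : 2 ≤ d) :
    GenNilCoxeter.wordSpan R (CoxeterMatrix.A n) (orderA n d) (1 + longestLength n d) = ⊥ := by
  refine GenNilCoxeter.wordSpan_eq_bot fun ω hω ↦ ?_
  rw [longestLength] at hω
  rcases isNormal_word R d hn hd ω with h | ⟨w, -, h⟩ | ⟨w, k, r, -, hk, hr, -, h⟩
  · exact h
  all_goals
    have := permLength_le_revPerm w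
    omega

end

end NCA

theorem mainTheorem3 (R : Type*) [CommRing R] (n d : ℕ) (hn : 1 ≤ n) (hd : 2 ≤ d) :
    -- the longest element of the symmetric group, and independence of `T_w` of reduced words
    (∀ w : Equiv.Perm (Fin n), w ≠ Fin.revPerm → permLength w < permLength (n := n) Fin.revPerm) ∧
    (∀ (w : Equiv.Perm (Fin n)) (ω : List (Fin (n - 1))), IsReducedWord ω w →
      NilA.Tw R w = GenNilCoxeter.word R _ _ ω ∧
      NCA.Tw R d w = NCA.word R n d (ω.map (NCA.incl n))) ∧
    -- the length function and the longest word
    (Nontrivial R →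
      -- the subalgebra generated by the first `n - 1` generators
      (Function.Injective (NCA.fromNilA R n d) ∧
        (NCA.fromNilA R n d).range = NCA.subalgR R n d ∧
        ∀ w : Equiv.Perm (Fin n), NCA.fromNilA R n d (NilA.Tw R w) = NCA.Tw R d w) ∧
      ∃ ℓ : GenNilCoxeter.NonzeroWord R (CoxeterMatrix.A n) (orderA n d) → ℕ,
        GenNilCoxeter.IsLengthFunction R _ _ ℓ ∧
        (∀ w : Equiv.Perm (Fin n),
          ∃ x : GenNilCoxeter.NonzeroWord R (CoxeterMatrix.A n) (orderA n d),
            x.1 = NCA.Tw R d w ∧ ℓ x = permLength w) ∧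
        (∀ (w : Equiv.Perm (Fin n)) (k m : ℕ), 1 ≤ k → k ≤ d - 1 → 1 ≤ m → m ≤ n →
          ∃ x : GenNilCoxeter.NonzeroWord R (CoxeterMatrix.A n) (orderA n d),
            x.1 = NCA.stdWord R d hn w k m ∧ ℓ x = permLength w + k + (n - m)) ∧
        ∃ x₀ : GenNilCoxeter.NonzeroWord R (CoxeterMatrix.A n) (orderA n d),
          x₀.1 = NCA.stdWord R d hn Fin.revPerm (d - 1) 1 ∧
          ℓ x₀ = NCA.longestLength n d ∧
          ∀ x, x ≠ x₀ → ℓ x < ℓ x₀) ∧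
    -- over a field the algebra is local, and its unique maximal left, right and two-sided ideal
    -- is the ideal generated by the generators
    (IsField R →
      IsLocalRing (NCA R n d) ∧
      (∀ J : TwoSidedIdeal (NCA R n d),
        IsCoatom J ↔ J = GenNilCoxeter.maxIdeal R (CoxeterMatrix.A n) (orderA n d)) ∧
      (∀ J : Ideal (NCA R n d), J.IsMaximal ↔
        (J : Set (NCA R n d)) = GenNilCoxeter.maxIdeal R (CoxeterMatrix.A n) (orderA n d)) ∧
      (∀ J : Submodule (NCA R n d)ᵐᵒᵖ (NCA R n d), IsCoatom J ↔
        (J : Set (NCA R n d)) = GenNilCoxeter.maxIdeal R (CoxeterMatrix.A n) (orderA n d))) ∧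
    -- nilpotency over every ground ring
    (GenNilCoxeter.maxIdeal R (CoxeterMatrix.A n) (orderA n d)).asIdeal ^
      (1 + NCA.longestLength n d) = ⊥ := by
  have he := NCA.orderA_ne_zero (n := n) hd
  refine ⟨fun w ↦ permLength_lt_revPerm,
    fun w ω h ↦ ⟨NilA.Tw_eq_word R h, NCA.Tw_eq_word R d h⟩, fun hR ↦ ⟨⟨?_, ?_, fun w ↦ ?_⟩, ?_⟩,
    fun hR ↦ ?_, ?_⟩
  · exact NCA.fromNilA_injective R n hd
  · exact NCA.range_fromNilA R n d
  · exact NCA.fromNilA_word R n d _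
  · have hℓ := GenNilCoxeter.isLengthFunction_wordLength (R := R) (e := orderA n d)
    have hstd : ∀ (w : Equiv.Perm (Fin n)) (k m : ℕ), 1 ≤ k → k ≤ d - 1 → 1 ≤ m → m ≤ n →
        ∃ x : GenNilCoxeter.NonzeroWord R (CoxeterMatrix.A n) (orderA n d),
          x.1 = NCA.stdWord R d hn w k m ∧
          GenNilCoxeter.wordLength x = permLength w + k + (n - m) := by
      intro w k m hk hkd hm hmn
      have h := NCA.stdWord_ne_zero R hn hd w hk hkd hm hmn
      rw [← NCA.word_stdLetters] at h
      exact ⟨⟨_, h, _, rfl⟩, NCA.word_stdLetters R hn w k m,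
        (hℓ _ h).trans (NCA.length_stdLetters hn w k hm hmn)⟩
    refine ⟨GenNilCoxeter.wordLength, hℓ, fun w ↦ ?_, hstd, ?_⟩
    · have h := NCA.Tw_ne_zero R hd w
      refine ⟨⟨_, h, _, rfl⟩, rfl, (hℓ _ h).trans ?_⟩
      rw [List.length_map, (isReducedWord_reducedWord w).2]
    · obtain ⟨x₀, h1, h2⟩ := hstd Fin.revPerm (d - 1) 1 (by omega) le_rfl le_rfl hn
      refine ⟨x₀, h1, by rw [h2, NCA.longestLength]; omega, ?_⟩
      rintro ⟨_, h0, ω, rfl⟩ hne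
      rw [hℓ ω h0, h2]
      rcases NCA.isNormal_word R d hn hd ω with h | ⟨w, -, h⟩ | ⟨w, k, r, -, hk, hr, hw, h⟩
      · exact absurd h h0
      · have := permLength_le_revPerm w
        omega
      · rw [h]
        -- The three summands `permLength w`, `k` and `r` are bounded separately, so reaching the
        -- maximal total forces equality in each.
        by_contra hlt
        have hle := permLength_le_revPerm w
        have hwrev : w = Fin.revPerm := by
          by_contra hwne
          have := permLength_lt_revPerm hwne
          omega
        subst hwrev
        obtain rfl : k = d - 1 := by omega
        obtain rfl : r = n - 1 := by omega
        rw [Nat.sub_sub_self hn] at hw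
        exact hne (Subtype.ext (hw.trans h1.symm))
  · have h := GenNilCoxeter.isUnit_iff_of_wordSpan_eq_bot hR he (NCA.wordSpan_eq_bot hn hd)
    exact ⟨IsLocalRing.of_twoSidedIdeal h, TwoSidedIdeal.isCoatom_iff_eq h,
      Ideal.isMaximal_iff_coe_eq h, Submodule.isCoatom_iff_coe_eq h⟩
  · refine eq_bot_iff.2 fun x hx ↦ ?_
    have := GenNilCoxeter.maxIdeal_pow_le_wordSpan he _ hx
    rw [NCA.wordSpan_eq_bot hn hd] at this
    exact (Submodule.mem_bot R).1 this
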